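/- Let $k$ be a field. A $k$-algebra (not necessarily associative or unital) is \emph{bicommutative} if $x(yz)=y(xz)$ and $(xy)z=(xz)y$ hold in it. For a finite-dimensional subspace $V$ of such an algebra $B$ put $V^1=V$, $V^n=\sum_{1\le i\le n-1}V^iV^{n-i}$ for $n\ge 2$, and $V^{\le n}=V^1+\dots+V^n$; then $$\mathrm{GKdim}\,B=\sup_V\limsup_{n\to\infty}\log_n\dim V^{\le n},$$ the supremum being over all finite-dimensional subspaces $V$ of $B$ (with $\log_n 0:=0$, so that $\mathrm{GKdim}\,0=0$). Let $X=\{x_1,\dots,x_r\}$ be a nonempty finite set, let $[X]^+$ be the free commutative semigroup on $X$, and let $BC(X)$ be the free bicommutative algebra on $X$. It has the linear basis $NF(X)=X\cup\{[u;v]: u,v\in[X]^+\}$ with the multiplication $zy=[z;y]$, $z[u;v]=[zu;v]$, $[u;v]z=[u;vz]$, $[u;v][u';v']=[uu';vv']$ for $z,y\in X$. The length of a letter is $1$ and that of $[u;v]$ is the number of letters of $u$ and $v$, with repetition. A letter $x$ divides every element of $NF(X)$ in which it occurs, and $[u;v]$ divides $[u';v']$ if $u\mid u'$ and $v\mid v'$.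 Fix a monomial order on $NF(X)$, that is, a well order $<$ such that $\mu<\nu$ implies $\mu\rho<\nu\rho$ and $\rho\mu<\rho\nu$ for all $\mu,\nu,\rho\in NF(X)$. Let $\bar f$ be the leading monomial of $0\ne f\in BC(X)$. Let $S\subseteq BC(X)$ be a set of nonzero elements with leading coefficient $1$, let $\mathrm{Id}(S)$ be the ideal generated by $S$, and put $BC(X|S)=BC(X)/\mathrm{Id}(S)$. The \emph{normal $S$-polynomials} are the elements of $S$ and, for $s\in S$ with $\bar s$ of length at least $2$, all $z_1(\cdots(z_p((\cdots(s\,y_1)\cdots)y_q))\cdots)$ with $z_i,y_j\in X$, $p,q\ge 0$. Let $\mathrm{Irr}(S)$ be the set of elements of $NF(X)$ that are not leading monomials of normal $S$-polynomials. $S$ is a \emph{Gröbner–Shirshov basis} for $BC(X|S)$ if the leading monomial of every nonzero element of $\mathrm{Id}(S)$ is the leading monomial of a normal $S$-polynomial. Let $N_S=1$ if $S=\emptyset$, and otherwise let $N_S$ be the least $n$ such that $\bar s$ divides $[x_1^n\cdots x_r^n;x_1^n\cdots x_r^n]$ for every $s\in S$ (for finite $S$). Let $\mathrm{Sd}([x_1^{n_1}\cdots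 x_r^{n_r};x_1^{m_1}\cdots x_r^{m_r}])$ be the number of $i$ with $n_i>N_S$ plus the number of $j$ with $m_j>N_S$, and for a finite set $B$ of such elements let $\mathrm{Sd}(B)=\max_{\mu\in B}\mathrm{Sd}(\mu)$, with $\mathrm{Sd}(\emptyset)=0$. \textbf{Theorem.} (1) Let $S$ be a finite Gröbner–Shirshov basis for $BC(X|S)$. Then the set $$B_S=\{\mu=[x_1^{n_1}\cdots x_r^{n_r};x_1^{m_1}\cdots x_r^{m_r}]\in\mathrm{Irr}(S)\setminus X : n_i,m_j\in\{0,1,N_S+1\}\text{ for all } i,j\}$$ is finite, and $\mathrm{GKdim}\,BC(X|S)=\mathrm{Sd}(B_S)$. (2) The Gelfand–Kirillov dimension of every finitely generated bicommutative algebra over a field is a nonnegative integer. -/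

import Mathlib

namespace Bicomm

universe u v w

/-- Bicommutativity: `x(yz) = y(xz)` and `(xy)z = (xz)y`. -/
class IsBicommutative (A : Type*) [Mul A] : Prop where
  left_comm : ∀ x y z : A, x * (y * z) = y * (x * z)
  right_comm : ∀ x y z : A, (x * y) * z = (x * z) * y

/-! ### The normal forms `NF(X)` -/

/-- The set `NF(X) = X ∪ {[u;v] | u, v ∈ [X]⁺}`. A word of the free commutative monoid `[X]` is
represented by the multiset of its letters, the exponent of `x` in `u` being `u.count x`. -/
inductive NF (X : Type u) : Type u where
  | letter (x : X) : NF X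
  | pair (u v : Multiset X) (hu : u ≠ 0) (hv : v ≠ 0) : NF X

namespace NF

variable {X : Type u}

/-- The multiplication table of `NF(X)`. -/
protected def mul : NF X → NF X → NF X
  | letter z, letter y => pair {z} {y} (Multiset.singleton_ne_zero z) (Multiset.singleton_ne_zero y)
  | letter z, pair u v _ hv => pair (z ::ₘ u) v (Multiset.cons_ne_zero) hv
  | pair u v hu _, letter z => pair u (z ::ₘ v) hu (Multiset.cons_ne_zero)
  | pair u v hu hv, pair u' v' _ _ => pair (u + u') (v + v')
      (fun h => hu (add_eq_zero.mp h).1) (fun h => hv (add_eq_zero.mp h).1)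

instance : Mul (NF X) := ⟨NF.mul⟩

theorem letter_mul_letter (z y : X) :
    letter z * letter y = pair {z} {y} (by simp) (by simp) := rfl

theorem letter_mul_pair (z : X) (u v : Multiset X) (hu : u ≠ 0) (hv : v ≠ 0) :
    letter z * pair u v hu hv = pair (z ::ₘ u) v (by simp) hv := rfl

theorem pair_mul_letter (z : X) (u v : Multiset X) (hu : u ≠ 0) (hv : v ≠ 0) :
    pair u v hu hv * letter z = pair u (z ::ₘ v) hu (by simp) := rfl

theorem pair_mul_pair (u v u' v' : Multiset X) (hu : u ≠ 0) (hv : v ≠ 0) (hu' : u' ≠ 0)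
    (hv' : v' ≠ 0) : pair u v hu hv * pair u' v' hu' hv' =
      pair (u + u') (v + v') (by simp [hu]) (by simp [hv]) := rfl

instance : IsBicommutative (NF X) where
  left_comm x y z := by
    cases x <;> cases y <;> cases z <;>
      simp only [letter_mul_letter, letter_mul_pair, pair_mul_letter, pair_mul_pair,
        ← Multiset.singleton_add] <;>
      congr 1 <;> abel
  right_comm x y z := by
    cases x <;> cases y <;> cases z <;>
      simp only [letter_mul_letter, letter_mul_pair, pair_mul_letter, pair_mul_pair,
        ← Multiset.singleton_add] <;>
      congr 1 <;> abel

/-- The number of letters, with repetition, of a normal form. -/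
def length : NF X → ℕ
  | letter _ => 1
  | pair u v _ _ => u.card + v.card

/-- `μ` divides `ν` (`ν` is a multiple of `μ`): either `μ` is a letter that occurs in `ν`, or
`μ = [u;v]`, `ν = [u';v']` with `u ∣ u'` and `v ∣ v'`. -/
def Divides : NF X → NF X → Prop
  | letter x, letter y => x = y
  | letter x, pair u v _ _ => x ∈ u ∨ x ∈ v
  | pair _ _ _ _, letter _ => False
  | pair u v _ _, pair u' v' _ _ => u ≤ u' ∧ v ≤ v'

/-- A monomial order on `NF(X)`: a (strict) well order that is compatible with multiplication from
both sides. -/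
structure IsMonomialOrder (r : NF X → NF X → Prop) : Prop where
  wellOrder : IsWellOrder (NF X) r
  mul_right : ∀ μ ν ρ, r μ ν → r (μ * ρ) (ν * ρ)
  mul_left : ∀ μ ν ρ, r μ ν → r (ρ * μ) (ρ * ν)

end NF

/-! ### The free bicommutative algebra -/

/-- The free bicommutative algebra `BC(X)`: the vector space with basis `NF(X)`, with the bilinear
multiplication that extends the multiplication table of `NF(X)`. That it is the free bicommutative
algebra on `X` is shown in `BC.isBicommutative` and `BC.existsUnique_hom`. -/
abbrev BC (k : Type v) [Field k] (X : Type u) : Type (max u v) := MonoidAlgebra k (NF X)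

namespace BC

variable {k : Type v} [Field k] {X : Type u}

/-- The basis element of `BC(X)` given by a normal form. -/
noncomputable def mono (μ : NF X) : BC k X := MonoidAlgebra.single μ 1

/-- The generator of `BC(X)` given by a letter. -/
noncomputable def gen (x : X) : BC k X := mono (NF.letter x)

instance isBicommutative : IsBicommutative (BC k X) where
  left_comm f g h := by
    induction f using MonoidAlgebra.induction_linear with
    | zero => simp
    | add f₁ f₂ h₁ h₂ => simp only [add_mul, mul_add, h₁, h₂]
    | single a α =>
      induction g using MonoidAlgebra.induction_linear with
      | zero => simp
      | add f₁ f₂ h₁ h₂ => simp only [add_mul, mul_add, h₁, h₂]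
      | single b β =>
        induction h using MonoidAlgebra.induction_linear with
        | zero => simp
        | add f₁ f₂ h₁ h₂ => simp only [mul_add, h₁, h₂]
        | single c γ =>
          simp only [MonoidAlgebra.single_mul_single, IsBicommutative.left_comm a b c]
          rw [mul_left_comm]
  right_comm f g h := by
    induction f using MonoidAlgebra.induction_linear with
    | zero => simp
    | add f₁ f₂ h₁ h₂ => simp only [add_mul, h₁, h₂]
    | single a α =>
      induction g using MonoidAlgebra.induction_linear with
      | zero => simp
      | add f₁ f₂ h₁ h₂ => simp only [add_mul, mul_add, h₁, h₂]
      | single b β =>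
        induction h using MonoidAlgebra.induction_linear with
        | zero => simp
        | add f₁ f₂ h₁ h₂ => simp only [add_mul, mul_add, h₁, h₂]
        | single c γ =>
          simp only [MonoidAlgebra.single_mul_single, IsBicommutative.right_comm a b c]
          rw [mul_right_comm]

end BC

/-! ### The universal property of `BC(X)` -/

section Universal

variable {A : Type w} [Mul A] [IsBicommutative A] {X : Type u} (g : X → A)

instance leftCommutative_gen : LeftCommutative (fun (x : X) (a : A) => g x * a) :=
  ⟨fun x y a => IsBicommutative.left_comm (g x) (g y) a⟩

instance rightCommutative_gen : RightCommutative (fun (a : A) (x : X) => a * g x) :=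
  ⟨fun a x y => IsBicommutative.right_comm a (g x) (g y)⟩

/-- Multiply `a` from the left by all letters of `u`. -/
def lmul (u : Multiset X) (a : A) : A := u.foldr (fun x a => g x * a) a

/-- Multiply `a` from the right by all letters of `v`. -/
def rmul (a : A) (v : Multiset X) : A := v.foldl (fun a x => a * g x) a

theorem lmul_cons (x : X) (u : Multiset X) (a : A) : lmul g (x ::ₘ u) a = g x * lmul g u a :=
  Multiset.foldr_cons _ _ _ _

theorem lmul_cons' (x : X) (u : Multiset X) (a : A) : lmul g (x ::ₘ u) a = lmul g u (g x * a) := by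
  induction u using Multiset.induction_on with
  | empty => simp [lmul]
  | cons y u ih => rw [Multiset.cons_swap, lmul_cons, ih, lmul_cons]

theorem rmul_cons (x : X) (v : Multiset X) (a : A) : rmul g a (x ::ₘ v) = rmul g (a * g x) v :=
  Multiset.foldl_cons _ _ _ _

theorem rmul_cons' (x : X) (v : Multiset X) (a : A) : rmul g a (x ::ₘ v) = rmul g a v * g x := by
  induction v using Multiset.induction_on generalizing a with
  | empty => rfl
  | cons y v ih => rw [Multiset.cons_swap, rmul_cons, ih, rmul_cons]

/-- `a((pq)b) = (a(pq))b`. -/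
theorem mul_mul_assoc_mid (a p q b : A) : a * ((p * q) * b) = (a * (p * q)) * b := by
  rw [IsBicommutative.right_comm p q b, IsBicommutative.left_comm a (p * b) q,
    IsBicommutative.right_comm p b (a * q), IsBicommutative.left_comm p a q]

theorem lmul_isMul (u : Multiset X) (p q : A) : ∃ p' q', lmul g u (p * q) = p' * q' := by
  induction u using Multiset.induction_on with
  | empty => exact ⟨p, q, rfl⟩
  | cons x u ih => exact ⟨g x, _, lmul_cons g x u _⟩

theorem lmul_mul (u : Multiset X) (p q b : A) :
    lmul g u ((p * q) * b) = lmul g u (p * q) * b := by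
  induction u using Multiset.induction_on with
  | empty => rfl
  | cons x u ih =>
    obtain ⟨p', q', h⟩ := lmul_isMul g u p q
    rw [lmul_cons, ih, lmul_cons, h, mul_mul_assoc_mid]

theorem lmul_rmul (u v : Multiset X) (p q : A) :
    lmul g u (rmul g (p * q) v) = rmul g (lmul g u (p * q)) v := by
  induction v using Multiset.induction_on generalizing p q with
  | empty => rfl
  | cons y v ih => rw [rmul_cons, ih, lmul_mul, rmul_cons]

open Classical in
/-- The image of a normal form under the homomorphism given by `g`. -/
noncomputable def evalNF : NF X → A
  | NF.letter x => g x
  | NF.pair u v _ hv =>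
    rmul g (lmul g u (g (Multiset.exists_mem_of_ne_zero hv).choose))
      (v.erase (Multiset.exists_mem_of_ne_zero hv).choose)

theorem evalNF_pair (z y : X) (u v : Multiset X) (hu : z ::ₘ u ≠ 0) (hv : y ::ₘ v ≠ 0) :
    evalNF g (NF.pair (z ::ₘ u) (y ::ₘ v) hu hv) = lmul g u (rmul g (g z * g y) v) := by
  classical
  have key : ∀ (y : X) (v : Multiset X), rmul g (lmul g (z ::ₘ u) (g y)) v =
      lmul g u (rmul g (g z) (y ::ₘ v)) := by
    intro y v
    rw [lmul_cons', ← lmul_rmul, rmul_cons]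
  have hc := (Multiset.exists_mem_of_ne_zero hv).choose_spec
  rw [evalNF, key, rmul_cons, ← rmul_cons g _ _ (g z)]
  rw [← rmul_cons]
  congr 2
  convert Multiset.cons_erase hc

theorem pair_cases {P : NF X → Prop} (hl : ∀ x, P (NF.letter x))
    (hp : ∀ z y u v, P (NF.pair (z ::ₘ u) (y ::ₘ v) (by simp) (by simp))) (μ : NF X) : P μ := by
  cases μ with
  | letter x => exact hl x
  | pair u v hu hv =>
    obtain ⟨z, hz⟩ := Multiset.exists_mem_of_ne_zero hu
    obtain ⟨y, hy⟩ := Multiset.exists_mem_of_ne_zero hv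
    obtain ⟨u, rfl⟩ := Multiset.exists_cons_of_mem hz
    obtain ⟨v, rfl⟩ := Multiset.exists_cons_of_mem hy
    exact hp z y u v

theorem evalNF_letter_mul (x : X) (ν : NF X) :
    evalNF g (NF.letter x * ν) = g x * evalNF g ν := by
  induction ν using pair_cases with
  | hl y =>
    rw [NF.letter_mul_letter]
    exact evalNF_pair g x y 0 0 _ _
  | hp z y u v =>
    rw [NF.letter_mul_pair, evalNF_pair, evalNF_pair, lmul_rmul, lmul_cons',
      IsBicommutative.left_comm, ← lmul_cons', ← lmul_rmul, lmul_cons]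

theorem evalNF_mul_letter (μ : NF X) (x : X) :
    evalNF g (μ * NF.letter x) = evalNF g μ * g x := by
  induction μ using pair_cases with
  | hl y =>
    rw [NF.letter_mul_letter]
    exact evalNF_pair g y x 0 0 _ _
  | hp z y u v =>
    rw [NF.pair_mul_letter, evalNF_pair, evalNF_pair, rmul_cons, IsBicommutative.right_comm,
      ← rmul_cons, lmul_rmul, rmul_cons', lmul_rmul]

theorem evalNF_pair_isMul (u v : Multiset X) (hu : u ≠ 0) (hv : v ≠ 0) :
    ∃ p q, evalNF g (NF.pair u v hu hv) = p * q := by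
  obtain ⟨z, hz⟩ := Multiset.exists_mem_of_ne_zero hu
  obtain ⟨y, hy⟩ := Multiset.exists_mem_of_ne_zero hv
  obtain ⟨u, rfl⟩ := Multiset.exists_cons_of_mem hz
  obtain ⟨v, rfl⟩ := Multiset.exists_cons_of_mem hy
  rw [evalNF_pair]
  have : ∃ p q, rmul g (g z * g y) v = p * q := by
    induction v using Multiset.induction_on with
    | empty => exact ⟨_, _, rfl⟩
    | cons x v ih => exact ⟨_, _, rmul_cons' g x v _⟩
  obtain ⟨p, q, h⟩ := this
  rw [h]
  exact lmul_isMul g u p q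

/-- Every normal form is a product of letters. -/
theorem NF.induction_mul {P : NF X → Prop} (hl : ∀ x, P (NF.letter x))
    (h1 : ∀ x μ, P μ → P (NF.letter x * μ)) (h2 : ∀ x μ, P μ → P (μ * NF.letter x))
    (μ : NF X) : P μ := by
  induction μ using pair_cases with
  | hl x => exact hl x
  | hp z y u v =>
    induction u using Multiset.induction_on with
    | empty =>
      induction v using Multiset.induction_on with
      | empty => exact h1 z _ (hl y)
      | cons x v ih =>
        have := h2 x _ ih
        rw [NF.pair_mul_letter] at this
        simpa only [Multiset.cons_swap x y] using this
    | cons x u ih =>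
      have := h1 x _ ih
      rw [NF.letter_mul_pair] at this
      simpa only [Multiset.cons_swap x z] using this

theorem evalNF_mul (μ ν : NF X) : evalNF g (μ * ν) = evalNF g μ * evalNF g ν := by
  cases ν with
  | letter x => exact evalNF_mul_letter g μ x
  | pair u' v' hu' hv' =>
    induction μ using NF.induction_mul with
    | hl x => exact evalNF_letter_mul g x _
    | h1 x μ ih =>
      obtain ⟨p, q, h⟩ := evalNF_pair_isMul g u' v' hu' hv'
      cases μ with
      | letter y =>
        have e : NF.letter x * NF.letter y * NF.pair u' v' hu' hv' =
            NF.letter x * NF.pair u' v' hu' hv' * NF.letter y :=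
          IsBicommutative.right_comm _ _ _
        rw [e, evalNF_mul_letter, evalNF_letter_mul, evalNF_letter_mul]
        exact IsBicommutative.right_comm _ _ _
      | pair u v hu hv =>
        have e : NF.letter x * NF.pair u v hu hv * NF.pair u' v' hu' hv' =
            NF.letter x * (NF.pair u v hu hv * NF.pair u' v' hu' hv') := by
          simp only [NF.letter_mul_pair, NF.pair_mul_pair, Multiset.cons_add]
        obtain ⟨p', q', h'⟩ := evalNF_pair_isMul g u v hu hv
        rw [e, evalNF_letter_mul, ih, evalNF_letter_mul, h', mul_mul_assoc_mid]
    | h2 x μ ih =>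
      rw [IsBicommutative.right_comm, evalNF_mul_letter, ih, evalNF_mul_letter,
        IsBicommutative.right_comm]

end Universal

/-- The universal property: every map from `X` to a bicommutative algebra extends uniquely to a
homomorphism of algebras on `BC(X)`. -/
theorem BC.existsUnique_hom {k : Type v} [Field k] {X : Type u} {A : Type w}
    [NonUnitalNonAssocRing A] [Module k A] [IsScalarTower k A A] [SMulCommClass k A A]
    [IsBicommutative A] (g : X → A) :
    ∃! φ : BC k X →ₙₐ[k] A, ∀ x, φ (BC.gen x) = g x := by
  refine ⟨MonoidAlgebra.liftMagma k ⟨evalNF g, evalNF_mul g⟩, fun x => ?_, fun ψ hψ => ?_⟩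
  · simp [BC.gen, BC.mono, evalNF]
  · apply (MonoidAlgebra.liftMagma k).symm.injective
    ext μ
    rw [Equiv.symm_apply_apply]
    change ψ (MonoidAlgebra.single μ 1) = evalNF g μ
    induction μ using NF.induction_mul with
    | hl x => exact hψ x
    | h1 x μ ih =>
      have : (MonoidAlgebra.single (NF.letter x * μ) 1 : BC k X) =
        MonoidAlgebra.single (NF.letter x) 1 * MonoidAlgebra.single μ 1 := by
        simp [MonoidAlgebra.single_mul_single]
      rw [this, map_mul, ih, evalNF_letter_mul]
      exact congrArg (· * _) (hψ x)
    | h2 x μ ih =>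
      have : (MonoidAlgebra.single (μ * NF.letter x) 1 : BC k X) =
        MonoidAlgebra.single μ 1 * MonoidAlgebra.single (NF.letter x) 1 := by
        simp [MonoidAlgebra.single_mul_single]
      rw [this, map_mul, ih, evalNF_mul_letter]
      exact congrArg (_ * ·) (hψ x)

/-! ### Ideals and quotient algebras -/

/-- A (two-sided) ideal of a not necessarily associative `k`-algebra. -/
structure AlgIdeal (k : Type v) (A : Type w) [Field k] [NonUnitalNonAssocRing A] [Module k A]
    extends Submodule k A where
  mul_mem_left' : ∀ (a : A) {b : A}, b ∈ toSubmodule → a * b ∈ toSubmodule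
  mul_mem_right' : ∀ {a : A} (b : A), a ∈ toSubmodule → a * b ∈ toSubmodule

namespace AlgIdeal

variable {k : Type v} {A : Type w} [Field k] [NonUnitalNonAssocRing A] [Module k A]

/-- The ideal `Id(S)` generated by a set `S`, the intersection of all ideals that contain `S`. -/
def span (k : Type v) {A : Type w} [Field k] [NonUnitalNonAssocRing A] [Module k A] (S : Set A) :
    AlgIdeal k A where
  toSubmodule := ⨅ (I : AlgIdeal k A) (_ : S ⊆ (I.toSubmodule : Set A)), I.toSubmodule
  mul_mem_left' a b hb := by
    simp only [Submodule.mem_iInf] at hb ⊢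
    exact fun I hI => I.mul_mem_left' a (hb I hI)
  mul_mem_right' b ha := by
    simp only [Submodule.mem_iInf] at ha ⊢
    exact fun I hI => I.mul_mem_right' b (ha I hI)

/-- The quotient algebra `A/I`. -/
def Quotient (I : AlgIdeal k A) : Type w := A ⧸ I.toSubmodule

namespace Quotient

variable (I : AlgIdeal k A)

instance : AddCommGroup I.Quotient := inferInstanceAs (AddCommGroup (A ⧸ I.toSubmodule))

instance : Module k I.Quotient := inferInstanceAs (Module k (A ⧸ I.toSubmodule))

/-- The quotient map. -/
def mk : A →ₗ[k] I.Quotient := I.toSubmodule.mkQ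

theorem mk_surjective : Function.Surjective (mk I) := I.toSubmodule.mkQ_surjective

theorem mk_eq_mk {a b : A} : mk I a = mk I b ↔ a - b ∈ I.toSubmodule :=
  Submodule.Quotient.eq I.toSubmodule

instance : Mul I.Quotient where
  mul := Quotient.map₂ (· * ·) (by
    intro a a' ha b b' hb
    have ha' := (Submodule.quotientRel_def _).mp ha
    have hb' := (Submodule.quotientRel_def _).mp hb
    refine (Submodule.quotientRel_def _).mpr ?_
    have : a * b - a' * b' = (a - a') * b + a' * (b - b') := by
      rw [sub_mul, mul_sub]; abel
    rw [this]
    exact I.toSubmodule.add_mem (I.mul_mem_right' b ha') (I.mul_mem_left' a' hb'))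

theorem mk_mul (a b : A) : mk I (a * b) = mk I a * mk I b := rfl

instance : NonUnitalNonAssocRing I.Quotient :=
  { (inferInstance : AddCommGroup I.Quotient), (inferInstance : Mul I.Quotient) with
    left_distrib := by
      intro x y z
      obtain ⟨a, rfl⟩ := mk_surjective I x
      obtain ⟨b, rfl⟩ := mk_surjective I y
      obtain ⟨c, rfl⟩ := mk_surjective I z
      simp only [← map_add, ← mk_mul, mul_add]
    right_distrib := by
      intro x y z
      obtain ⟨a, rfl⟩ := mk_surjective I x
      obtain ⟨b, rfl⟩ := mk_surjective I y
      obtain ⟨c, rfl⟩ := mk_surjective I z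
      simp only [← map_add, ← mk_mul, add_mul]
    zero_mul := by
      intro x
      obtain ⟨a, rfl⟩ := mk_surjective I x
      rw [← map_zero (mk I), ← mk_mul, zero_mul]
    mul_zero := by
      intro x
      obtain ⟨a, rfl⟩ := mk_surjective I x
      rw [← map_zero (mk I), ← mk_mul, mul_zero] }

instance [IsScalarTower k A A] : IsScalarTower k I.Quotient I.Quotient where
  smul_assoc c x y := by
    obtain ⟨a, rfl⟩ := mk_surjective I x
    obtain ⟨b, rfl⟩ := mk_surjective I y
    simp only [smul_eq_mul, ← map_smul, ← mk_mul, smul_mul_assoc]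

instance [SMulCommClass k A A] : SMulCommClass k I.Quotient I.Quotient where
  smul_comm c x y := by
    obtain ⟨a, rfl⟩ := mk_surjective I x
    obtain ⟨b, rfl⟩ := mk_surjective I y
    simp only [smul_eq_mul, ← map_smul, ← mk_mul, mul_smul_comm]

instance [IsBicommutative A] : IsBicommutative I.Quotient where
  left_comm x y z := by
    obtain ⟨a, rfl⟩ := mk_surjective I x
    obtain ⟨b, rfl⟩ := mk_surjective I y
    obtain ⟨c, rfl⟩ := mk_surjective I z
    simp only [← mk_mul, IsBicommutative.left_comm a b c]
  right_comm x y z := by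
    obtain ⟨a, rfl⟩ := mk_surjective I x
    obtain ⟨b, rfl⟩ := mk_surjective I y
    obtain ⟨c, rfl⟩ := mk_surjective I z
    simp only [← mk_mul, IsBicommutative.right_comm a b c]

end Quotient

end AlgIdeal

/-! ### Gelfand-Kirillov dimension -/

section GKdim

variable {k : Type v} {A : Type w} [Field k] [NonUnitalNonAssocRing A] [Module k A]

/-- The subspace `(V W)` spanned by all products `x y` with `x ∈ V`, `y ∈ W`. -/
def mulSpan (V W : Submodule k A) : Submodule k A :=
  Submodule.span k {a | ∃ x ∈ V, ∃ y ∈ W, a = x * y}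

/-- `V¹ = V` and `Vⁿ = ∑_{1 ≤ i ≤ n-1} (Vⁱ Vⁿ⁻ⁱ)` for `n ≥ 2` (and `V⁰ = 0`, which is not used). -/
def powSpan (V : Submodule k A) : ℕ → Submodule k A
  | 0 => ⊥
  | 1 => V
  | n + 2 => ⨆ i : Fin (n + 1), mulSpan (powSpan V ((i : ℕ) + 1)) (powSpan V (n + 1 - (i : ℕ)))
  termination_by n => n
  decreasing_by all_goals omega

/-- `V^{≤ n} = V¹ + ⋯ + Vⁿ`. -/
def powLE (V : Submodule k A) (n : ℕ) : Submodule k A :=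
  ⨆ i ∈ Finset.Icc 1 n, powSpan V i

/-- The Gelfand-Kirillov dimension
`sup_V limsup_{n → ∞} log_n dim V^{≤ n}`, the supremum being over all finite-dimensional subspaces
`V`. As `Real.logb n 0 = 0`, the subspace `V = 0` contributes `0`. -/
noncomputable def GKdim (k : Type v) (A : Type w) [Field k] [NonUnitalNonAssocRing A]
    [Module k A] : EReal :=
  ⨆ (V : Submodule k A) (_ : FiniteDimensional k V),
    Filter.limsup (fun n : ℕ => ((Real.logb n (Module.finrank k (powLE V n)) : ℝ) : EReal))
      Filter.atTop

end GKdim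

/-! ### Gröbner-Shirshov bases -/

section GSB

variable {k : Type v} [Field k] {X : Type u} (r : NF X → NF X → Prop)

/-- `μ` is the leading monomial of `f` (in particular `f ≠ 0`). -/
def IsLeading (f : BC k X) (μ : NF X) : Prop :=
  f.coeff μ ≠ 0 ∧ ∀ ν, f.coeff ν ≠ 0 → ν ≠ μ → r ν μ

/-- Every element of `S` is nonzero with leading coefficient `1`. -/
def IsMonicSet (S : Set (BC k X)) : Prop :=
  ∀ s ∈ S, ∃ μ, IsLeading r s μ ∧ s.coeff μ = 1

/-- Normal `S`-polynomials: the elements `s` of `S`, and for those `s ∈ S` whose leading monomial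
has length at least `2` also all `(z₁(⋯(z_p((⋯(s y₁)⋯)y_q))⋯))` with letters
`z₁, …, z_p, y₁, …, y_q`, where `p, q ≥ 0`. -/
def IsNormalPoly (S : Set (BC k X)) (h : BC k X) : Prop :=
  h ∈ S ∨ ∃ s ∈ S, ∃ μ, IsLeading r s μ ∧ 2 ≤ μ.length ∧ ∃ zs ys : List X,
    h = zs.foldr (fun z f => BC.gen z * f) (ys.foldl (fun f y => f * BC.gen y) s)

/-- `Irr(S)`: the normal forms that are not the leading monomial of a normal `S`-polynomial. -/
def Irr (S : Set (BC k X)) : Set (NF X) :=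
  {μ | ¬ ∃ h, IsNormalPoly r S h ∧ IsLeading r h μ}

/-- `S` is a Gröbner-Shirshov basis for `BC(X)/I`. -/
structure IsGSB (S : Set (BC k X)) (I : AlgIdeal k (BC k X)) : Prop where
  monic : IsMonicSet r S
  span_eq : AlgIdeal.span k S = I
  leading : ∀ f ∈ I.toSubmodule, f ≠ 0 →
    ∃ h μ, IsNormalPoly r S h ∧ IsLeading r h μ ∧ IsLeading r f μ

/-- `BC(X|S) = BC(X)/Id(S)`. -/
abbrev BCPres (S : Set (BC k X)) : Type (max u v) := (AlgIdeal.span k S).Quotient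

variable [Fintype X]

open Classical in
/-- `N_S`: it is `1` if `S` is empty, and otherwise the least `n` such that the leading monomials of
all elements of `S` divide `[x₁ⁿ⋯x_rⁿ; x₁ⁿ⋯x_rⁿ]`. -/
noncomputable def NS (S : Set (BC k X)) : ℕ :=
  if S = ∅ then 1
  else sInf {n | ∃ hn : n • (Finset.univ : Finset X).val ≠ 0, ∀ s ∈ S, ∀ μ, IsLeading r s μ →
    μ.Divides (NF.pair (n • Finset.univ.val) (n • Finset.univ.val) hn hn)}

open Classical in
/-- `Sd(μ)`, relative to the bound `N`: `0` for letters, and the number of exponents that exceed `N`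
for `μ = [u;v]`. -/
noncomputable def Sd (N : ℕ) : NF X → ℕ
  | NF.letter _ => 0
  | NF.pair u v _ _ =>
    (Finset.univ.filter fun x => N < u.count x).card +
      (Finset.univ.filter fun x => N < v.count x).card

/-- `Sd(B) = max {Sd(μ) | μ ∈ B}`, and `Sd(∅) = 0`. The values `Sd(μ)` are bounded by `2 |X|`, so
that the supremum in `ℕ` is a maximum. -/
noncomputable def SdSet (N : ℕ) (B : Set (NF X)) : ℕ := sSup (Sd N '' B)

open Classical in
/-- The normal forms `[x₁^{n₁}⋯x_r^{n_r}; x₁^{m₁}⋯x_r^{m_r}]` in `Irr(S) ∖ X` all of whose exponents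
`n_i`, `m_j` lie in `{0, 1, N_S + 1}`. -/
def testSet (S : Set (BC k X)) : Set (NF X) :=
  {μ ∈ Irr r S | ∃ u v hu hv, μ = NF.pair u v hu hv ∧
    ∀ x, u.count x ∈ ({0, 1, NS r S + 1} : Set ℕ) ∧ v.count x ∈ ({0, 1, NS r S + 1} : Set ℕ)}

end GSB

end Bicomm

/-! The growth of a quotient of the free algebra is governed by its irreducible monomials. Let φ be
the quotient map. The images of the pairs [u;v] that are not leading monomials of elements of the
kernel are linearly independent, and together with the finitely many letters they span.
Multiplication by letters produces all multiples of a leading pair, so a pair is irreducible when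
its exponent vector avoids an upward closed set generated by finitely many vectors: those of the
leading pairs of S in part (1), and the minimal ones, finite in number by Dickson's lemma, in part
(2) (`exists_isLeadBasis`). If N bounds the exponents of these generators, an exponent already above
N can be raised freely without losing irreducibility. Hence an irreducible pair with d exponents
above N yields at least a constant times n^d irreducible pairs of length at most n, for large n; and
if no irreducible pair has more than d such exponents, there are only O(n^d) of them.

The obstacle is that a monomial order need not respect length, so reduction may lengthen monomials.
Only finitely many comparisons matter, however: the exponent differences inside finitely many
polynomials, and the unit vectors. They lie in `NF.posCone`, a set closed under addition that omits
0, so Gordan's alternative gives an integral linear functional that is positive on all of them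
(`exists_weight`). The resulting weight never increases under reduction and is comparable with
length, so monomials of length at most n reduce to letters and irreducible pairs of length at most
Kn (`IsLeadBasis.exists_lengthLE_le`). The factor K disappears in the limsup, and
`IsLeadBasis.GKdim_eq` joins both bounds.

For (1), the maximal number of exponents above N is already attained on the test set, because
truncating an irreducible pair keeps it irreducible (`exists_mem_testSet`). For (2), any monomial
order on the free algebra over the generators will do. -/

namespace Bicomm

/-! ### Gordan's alternative -/

/-- Gordan's alternative for a finite family in a cone of an abelian group. -/
theorem exists_addMonoidHom_pos {G : Type*} [AddCommGroup G]
    (hG : ∀ a : G, a ≠ 0 → ∃ f : G →+ ℤ, 0 < f a) (P : Set G)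
    (hadd : ∀ a ∈ P, ∀ b ∈ P, a + b ∈ P) (h0 : (0 : G) ∉ P) (n : ℕ) :
    ∀ d : Fin n → G, (∀ i, d i ∈ P) → ∃ f : G →+ ℤ, ∀ i, 0 < f (d i) := by
  have hsmul : ∀ m : ℕ, ∀ a ∈ P, (m + 1) • a ∈ P := by
    intro m a ha
    induction m with
    | zero => simpa using ha
    | succ m ih => rw [succ_nsmul]; exact hadd _ ih _ ha
  have hzsmul : ∀ m : ℤ, 0 < m → ∀ a ∈ P, m • a ∈ P := by
    intro m hm a ha
    obtain ⟨j, rfl⟩ : ∃ j : ℕ, m = ((j + 1 : ℕ) : ℤ) := ⟨(m - 1).toNat, by push_cast; omega⟩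
    rw [natCast_zsmul]
    exact hsmul j a ha
  have hbound : ∀ {m : ℕ} (a : Fin m → ℤ), ∃ K : ℤ, 0 < K ∧ ∀ i, |a i| < K := by
    intro m a
    refine ⟨∑ i, |a i| + 1, by positivity, fun i => ?_⟩
    have := Finset.single_le_sum (f := fun i => |a i|) (fun i _ => abs_nonneg (a i))
      (Finset.mem_univ i)
    exact Int.lt_add_one_of_le this
  induction n with
  | zero => exact fun d _ => ⟨0, fun i => i.elim0⟩
  | succ n ih =>
    intro d hd
    -- A single vector is treated apart: the case f (d 0) = 0 below needs another vector to conclude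
    -- that g (d 0) > 0.
    rcases Nat.eq_zero_or_pos n with rfl | hn
    · obtain ⟨f, hf⟩ := hG (d 0) (fun h => h0 (h ▸ hd 0))
      exact ⟨f, fun i => by rwa [show i = 0 from Fin.fin_one_eq_zero i]⟩
    obtain ⟨f, hf⟩ := ih (fun i => d i.succ) (fun i => hd _)
    by_cases hf0 : 0 < f (d 0)
    · exact ⟨f, fun i => Fin.cases hf0 hf i⟩
    push Not at hf0
    -- Eliminate d 0: these combinations lie in the kernel of f, and in P because -f (d 0) ≥ 0 and f
    -- (d i.succ) > 0.
    obtain ⟨g, hg⟩ := ih (fun i => (-f (d 0)) • d i.succ + f (d i.succ) • d 0) (fun i => by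
      rcases hf0.eq_or_lt with h | h
      · simpa [h] using hzsmul _ (hf i) _ (hd 0)
      · exact hadd _ (hzsmul _ (by omega) _ (hd _)) _ (hzsmul _ (hf i) _ (hd _)))
    simp only [map_add, map_zsmul, smul_eq_mul] at hg
    rcases hf0.eq_or_lt with h | h
    · have hg0 : 0 < g (d 0) := by
        have h1 := hg ⟨0, hn⟩
        rw [h] at h1
        simp only [neg_zero, zero_mul, zero_add] at h1
        exact pos_of_mul_pos_right h1 (hf _).le
      obtain ⟨K, hK, hK'⟩ := hbound (fun i : Fin n => g (d i.succ))
      refine ⟨g + K • f, fun i => Fin.cases ?_ (fun i => ?_) i⟩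
      · simpa [h] using hg0
      · have h1 := (abs_lt.mp (hK' i)).1
        have h2 := hf i
        simp only [AddMonoidHom.add_apply, AddMonoidHom.smul_apply, smul_eq_mul]
        nlinarith
    · obtain ⟨K, hK, hK'⟩ := hbound (fun i : Fin n => f (d i.succ))
      -- The bracket vanishes on d 0 and is at least 1 on the other vectors, where the factor K
      -- outweighs f. Subtracting f contributes -f (d 0) > 0 on d 0.
      refine ⟨K • ((-f (d 0)) • g + g (d 0) • f) - f, fun i => Fin.cases ?_ (fun i => ?_) i⟩
      · simp only [AddMonoidHom.add_apply, AddMonoidHom.smul_apply, smul_eq_mul,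
          AddMonoidHom.sub_apply]
        have : K * (-f (d 0) * g (d 0) + g (d 0) * f (d 0)) = 0 := by ring
        omega
      · have h1 := (abs_lt.mp (hK' i)).2
        have h2 := hg i
        simp only [AddMonoidHom.add_apply, AddMonoidHom.smul_apply, smul_eq_mul,
          AddMonoidHom.sub_apply]
        have h3 : 1 ≤ -f (d 0) * g (d i.succ) + g (d 0) * f (d i.succ) := by linarith
        nlinarith

/-! ### Length, divisibility and exponent vectors of normal forms -/

namespace NF

variable {X : Type*}

/-- The normal forms `[u;v]`. -/
def IsPair : NF X → Prop
  | letter _ => False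
  | pair _ _ _ _ => True

theorem isPair_mul (μ ν : NF X) : (μ * ν).IsPair := by
  cases μ <;> cases ν <;> trivial

theorem length_mul (μ ν : NF X) : (μ * ν).length = μ.length + ν.length := by
  cases μ <;> cases ν <;>
    simp only [letter_mul_letter, letter_mul_pair, pair_mul_letter, pair_mul_pair, length,
      Multiset.card_cons, Multiset.card_singleton, Multiset.card_add] <;> omega

theorem isPair_of_two_le_length {μ : NF X} (h : 2 ≤ μ.length) : μ.IsPair := by
  cases μ with
  | letter x => simp [length] at h
  | pair => trivial

theorem IsPair.two_le_length {μ : NF X} (h : μ.IsPair) : 2 ≤ μ.length := by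
  cases μ with
  | letter x => exact h.elim
  | pair u v hu hv =>
    have := Multiset.card_pos.mpr hu
    have := Multiset.card_pos.mpr hv
    simp only [length]; omega

theorem one_le_length (μ : NF X) : 1 ≤ μ.length := by
  cases μ with
  | letter x => exact le_rfl
  | pair u v hu hv => exact le_trans (by omega) (IsPair.two_le_length (μ := pair u v hu hv) trivial)

theorem Divides.refl (μ : NF X) : μ.Divides μ := by
  cases μ <;> simp [Divides]

theorem IsPair.divides_trans {μ ν ρ : NF X} (hμ : μ.IsPair) (h1 : μ.Divides ν)
    (h2 : ν.Divides ρ) : μ.Divides ρ := by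
  cases μ with
  | letter x => exact hμ.elim
  | pair u v hu hv =>
    cases ν with
    | letter x => exact h1.elim
    | pair u v hu hv =>
      cases ρ with
      | letter x => exact h2.elim
      | pair u v hu hv => exact ⟨h1.1.trans h2.1, h1.2.trans h2.2⟩

/-- Every multiple of a pair arises from multiplications by letters. -/
theorem divides_induction {P : NF X → Prop} {μ : NF X} (hμ : μ.IsPair) (h0 : P μ)
    (hl : ∀ z ν, ν.IsPair → P ν → P (letter z * ν)) (hr : ∀ z ν, ν.IsPair → P ν → P (ν * letter z))
    {ν : NF X} (h : μ.Divides ν) : P ν := by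
  cases μ with
  | letter x => exact hμ.elim
  | pair u v hu hv =>
    cases ν with
    | letter x => exact h.elim
    | pair u' v' hu' hv' =>
      obtain ⟨a, rfl⟩ := Multiset.le_iff_exists_add.mp h.1
      obtain ⟨b, rfl⟩ := Multiset.le_iff_exists_add.mp h.2
      clear h
      induction a using Multiset.induction_on with
      | empty =>
        induction b using Multiset.induction_on with
        | empty => simpa using h0
        | cons x b ih =>
          have := hr x (pair _ _ _ _) trivial (ih (by simp [hv]))
          simpa only [pair_mul_letter, Multiset.add_cons] using this
      | cons x a ih =>
        have := hl x (pair _ _ _ _) trivial (ih (by simp [hu]))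
        simpa only [letter_mul_pair, Multiset.add_cons] using this

/-- Multiplication by a letter from the left is injective. -/
theorem letter_mul_injective (z : X) : Function.Injective (fun μ : NF X => letter z * μ) := by
  intro μ ν h
  have hl := congrArg length h
  cases μ with
  | letter x =>
    cases ν with
    | letter y => simpa [letter_mul_letter] using h
    | pair u v hu hv =>
      have := IsPair.two_le_length (μ := pair u v hu hv) trivial
      simp only [length_mul] at hl
      simp only [length] at hl this; omega
  | pair u v hu hv =>
    cases ν with
    | letter x =>
      have := IsPair.two_le_length (μ := pair u v hu hv) trivial
      simp only [length_mul] at hl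
      simp only [length] at hl this; omega
    | pair => simpa [letter_mul_pair] using h

/-- Multiplication by a letter from the right is injective. -/
theorem mul_letter_injective (z : X) : Function.Injective (fun μ : NF X => μ * letter z) := by
  intro μ ν h
  have hl := congrArg length h
  cases μ with
  | letter x =>
    cases ν with
    | letter y => simpa [letter_mul_letter] using h
    | pair u v hu hv =>
      have := IsPair.two_le_length (μ := pair u v hu hv) trivial
      simp only [length_mul] at hl
      simp only [length] at hl this; omega
  | pair u v hu hv =>
    cases ν with
    | letter x =>
      have := IsPair.two_le_length (μ := pair u v hu hv) trivial
      simp only [length_mul] at hl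
      simp only [length] at hl this; omega
    | pair => simpa [pair_mul_letter] using h

open Classical in
/-- The exponent vector of a word. -/
noncomputable def cnt : Multiset X →+ (X → ℤ) where
  toFun u x := (u.count x : ℤ)
  map_zero' := by ext; simp
  map_add' u v := by ext; simp

theorem cnt_injective : Function.Injective (cnt : Multiset X → X → ℤ) := by
  classical
  intro u v h
  ext x
  have := congrFun h x
  simpa [cnt] using this

/-- The exponent vector of a normal form; a letter is counted on the left. -/
noncomputable def expL : NF X → (X → ℤ) × (X → ℤ)
  | letter y => (cnt {y}, 0)
  | pair u v _ _ => (cnt u, cnt v)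

/-- The exponent vector of a normal form; a letter is counted on the right. -/
noncomputable def expR : NF X → (X → ℤ) × (X → ℤ)
  | letter y => (0, cnt {y})
  | pair u v _ _ => (cnt u, cnt v)

theorem IsPair.expR_eq {μ : NF X} (h : μ.IsPair) : μ.expR = μ.expL := by
  cases μ with
  | letter x => exact h.elim
  | pair => rfl

/-- A letter becomes a left factor when multiplied from the right, and a right factor when
multiplied from the left. This is why two exponent vectors are kept; they differ only on letters. -/
theorem expL_mul_letter (μ : NF X) (z : X) : (μ * letter z).expL = μ.expL + (0, cnt {z}) := by
  cases μ <;> simp [letter_mul_letter, pair_mul_letter, expL, ← Multiset.singleton_add, add_comm]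

theorem expL_letter_mul (z : X) (μ : NF X) : (letter z * μ).expL = (cnt {z}, 0) + μ.expR := by
  cases μ <;> simp [letter_mul_letter, letter_mul_pair, expL, expR, ← Multiset.singleton_add]

theorem IsPair.expL_mul {μ ν : NF X} (hμ : μ.IsPair) (hν : ν.IsPair) :
    (μ * ν).expL = μ.expL + ν.expL := by
  cases μ with
  | letter x => exact hμ.elim
  | pair =>
    cases ν with
    | letter x => exact hν.elim
    | pair => simp [pair_mul_pair, expL]

theorem IsPair.expL_inj {μ ν : NF X} (hμ : μ.IsPair) (hν : ν.IsPair) (h : μ.expL = ν.expL) :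
    μ = ν := by
  cases μ with
  | letter x => exact hμ.elim
  | pair =>
    cases ν with
    | letter x => exact hν.elim
    | pair =>
      simp only [expL, Prod.mk.injEq] at h
      simp [cnt_injective h.1, cnt_injective h.2]

/-! ### The positive cone of a monomial order -/

section Order

variable {r : NF X → NF X → Prop}

/-- If zμ < μ, multiplying by z gives z(zμ) < zμ, so the smaller pair zμ is also a counterexample,
against well-foundedness. Equality is excluded by length. -/
theorem IsMonomialOrder.lt_letter_mul (hr : IsMonomialOrder r) (z : X) {μ : NF X}
    (hμ : μ.IsPair) : r μ (letter z * μ) := by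
  have := hr.wellOrder
  induction μ using (IsWellFounded.wf (r := r)).induction with
  | _ μ ih =>
    rcases trichotomous_of r μ (letter z * μ) with h | h | h
    · exact h
    · have := congrArg length h
      simp only [length_mul] at this
      simp [length] at this
    · exact (asymm_of r (ih _ h (isPair_mul _ _)) (hr.mul_left _ _ (letter z) h)).elim

theorem IsMonomialOrder.lt_mul_letter (hr : IsMonomialOrder r) (z : X) {μ : NF X}
    (hμ : μ.IsPair) : r μ (μ * letter z) := by
  have := hr.wellOrder
  induction μ using (IsWellFounded.wf (r := r)).induction with
  | _ μ ih =>
    rcases trichotomous_of r μ (μ * letter z) with h | h | h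
    · exact h
    · have := congrArg length h
      simp only [length_mul] at this
      simp [length] at this
    · exact (asymm_of r (ih _ h (isPair_mul _ _)) (hr.mul_right _ _ (letter z) h)).elim

/-- The differences of exponent vectors of comparable pairs. -/
def posCone (r : NF X → NF X → Prop) : Set ((X → ℤ) × (X → ℤ)) :=
  {a | ∃ μ ν : NF X, μ.IsPair ∧ ν.IsPair ∧ r ν μ ∧ a = μ.expL - ν.expL}

theorem IsMonomialOrder.posCone_add (hr : IsMonomialOrder r) :
    ∀ a ∈ posCone r, ∀ b ∈ posCone r, a + b ∈ posCone r := by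
  have := hr.wellOrder
  rintro _ ⟨μ, ν, hμ, hν, h, rfl⟩ _ ⟨μ', ν', hμ', hν', h', rfl⟩
  refine ⟨μ * μ', ν * ν', isPair_mul _ _, isPair_mul _ _,
    trans_of r (hr.mul_right _ _ ν' h) (hr.mul_left _ _ μ h'), ?_⟩
  rw [hμ.expL_mul hμ', hν.expL_mul hν']
  abel

theorem IsMonomialOrder.zero_notMem_posCone (hr : IsMonomialOrder r) : 0 ∉ posCone r := by
  have := hr.wellOrder
  rintro ⟨μ, ν, hμ, hν, h, e⟩
  rw [hμ.expL_inj hν (sub_eq_zero.mp e.symm)] at h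
  exact irrefl_of r _ h

/-- The smaller monomial may be a letter, so both sides are first multiplied by a letter from the
right. This makes them pairs and cancels in the difference; multiplication from the left gives the
version with `expR`. -/
theorem IsMonomialOrder.sub_expL_mem (hr : IsMonomialOrder r) {μ ν : NF X} (hμ : μ.IsPair)
    (h : r ν μ) : μ.expL - ν.expL ∈ posCone r := by
  obtain ⟨z⟩ : Nonempty X := by
    cases μ with
    | letter x => exact ⟨x⟩
    | pair u v hu hv => exact ⟨(Multiset.exists_mem_of_ne_zero hu).choose⟩
  refine ⟨μ * letter z, ν * letter z, isPair_mul _ _, isPair_mul _ _, hr.mul_right _ _ _ h, ?_⟩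
  rw [expL_mul_letter, expL_mul_letter]
  abel

theorem IsMonomialOrder.sub_expR_mem (hr : IsMonomialOrder r) {μ ν : NF X} (hμ : μ.IsPair)
    (h : r ν μ) : μ.expL - ν.expR ∈ posCone r := by
  obtain ⟨z⟩ : Nonempty X := by
    cases μ with
    | letter x => exact ⟨x⟩
    | pair u v hu hv => exact ⟨(Multiset.exists_mem_of_ne_zero hu).choose⟩
  refine ⟨letter z * μ, letter z * ν, isPair_mul _ _, isPair_mul _ _, hr.mul_left _ _ _ h, ?_⟩
  rw [expL_letter_mul, expL_letter_mul, hμ.expR_eq]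
  abel

theorem IsMonomialOrder.cnt_left_mem (hr : IsMonomialOrder r) (z : X) :
    ((cnt {z}, 0) : (X → ℤ) × (X → ℤ)) ∈ posCone r := by
  have h := isPair_mul (letter z) (letter z)
  refine ⟨_, _, isPair_mul _ _, h, hr.lt_letter_mul z h, ?_⟩
  rw [expL_letter_mul z (letter z * letter z), h.expR_eq, add_sub_cancel_right]

theorem IsMonomialOrder.cnt_right_mem (hr : IsMonomialOrder r) (z : X) :
    ((0, cnt {z}) : (X → ℤ) × (X → ℤ)) ∈ posCone r := by
  have h := isPair_mul (letter z) (letter z)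
  refine ⟨_, _, isPair_mul _ _, h, hr.lt_mul_letter z h, ?_⟩
  rw [expL_mul_letter (letter z * letter z), add_sub_cancel_left]

/-- A finite subset of the positive cone of a monomial order lies in an open half space. -/
theorem IsMonomialOrder.exists_pos (hr : IsMonomialOrder r) {D : Set ((X → ℤ) × (X → ℤ))}
    (hD : D.Finite) (h : D ⊆ posCone r) : ∃ f : (X → ℤ) × (X → ℤ) →+ ℤ, ∀ d ∈ D, 0 < f d := by
  have hG : ∀ a : (X → ℤ) × (X → ℤ), a ≠ 0 → ∃ f : (X → ℤ) × (X → ℤ) →+ ℤ, 0 < f a := by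
    intro a ha
    have key : ∃ f : (X → ℤ) × (X → ℤ) →+ ℤ, f a ≠ 0 := by
      by_contra! hf
      apply ha
      ext x
      · exact hf ((Pi.evalAddMonoidHom _ x).comp (AddMonoidHom.fst _ _))
      · exact hf ((Pi.evalAddMonoidHom _ x).comp (AddMonoidHom.snd _ _))
    obtain ⟨f, hf⟩ := key
    rcases hf.lt_or_gt with hf | hf
    · exact ⟨-f, by simpa using hf⟩
    · exact ⟨f, hf⟩
  obtain ⟨n, d, rfl⟩ : ∃ (n : ℕ) (d : Fin n → _), Set.range d = D := by
    have := hD.to_subtype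
    obtain ⟨n, ⟨e⟩⟩ := Finite.exists_equiv_fin D
    exact ⟨n, fun i => (e.symm i).1, by
      ext a
      exact ⟨fun ⟨i, hi⟩ => hi ▸ (e.symm i).2, fun ha => ⟨e ⟨a, ha⟩, by simp⟩⟩⟩
  obtain ⟨f, hf⟩ := exists_addMonoidHom_pos hG (posCone r) hr.posCone_add
    hr.zero_notMem_posCone n d (fun i => h ⟨i, rfl⟩)
  exact ⟨f, by rintro _ ⟨i, rfl⟩; exact hf i⟩

end Order

end NF

/-! ### Leading monomials under multiplication by letters -/

section Leading

variable {k : Type*} [Field k] {X : Type*} {r : NF X → NF X → Prop}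

theorem BC.coeff_gen_mul (z : X) (f : BC k X) :
    (BC.gen z * f).coeff = f.coeff.mapDomain (NF.letter z * ·) := by
  induction f using MonoidAlgebra.induction_linear with
  | zero => simp
  | add f g hf hg => simp only [mul_add, MonoidAlgebra.coeff_add, hf, hg, Finsupp.mapDomain_add]
  | single a c => simp [BC.gen, BC.mono, MonoidAlgebra.single_mul_single, Finsupp.mapDomain_single]

theorem BC.coeff_mul_gen (f : BC k X) (z : X) :
    (f * BC.gen z).coeff = f.coeff.mapDomain (· * NF.letter z) := by
  induction f using MonoidAlgebra.induction_linear with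
  | zero => simp
  | add f g hf hg => simp only [add_mul, MonoidAlgebra.coeff_add, hf, hg, Finsupp.mapDomain_add]
  | single a c => simp [BC.gen, BC.mono, MonoidAlgebra.single_mul_single, Finsupp.mapDomain_single]

theorem exists_coeff_ne_zero_of_mapDomain {α β R : Type*} [AddCommMonoid R] {e : α → β}
    {f : α →₀ R} {b : β} (h : f.mapDomain e b ≠ 0) : ∃ a, f a ≠ 0 ∧ b = e a := by
  classical
  have := Finsupp.mapDomain_support (Finsupp.mem_support_iff.mpr h)
  obtain ⟨a, ha, rfl⟩ := Finset.mem_image.mp this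
  exact ⟨a, Finsupp.mem_support_iff.mp ha, rfl⟩

theorem IsLeading.gen_mul (hr : NF.IsMonomialOrder r) (z : X) {f : BC k X} {μ : NF X}
    (h : IsLeading r f μ) : IsLeading r (BC.gen z * f) (NF.letter z * μ) := by
  rw [IsLeading, BC.coeff_gen_mul, Finsupp.mapDomain_apply (NF.letter_mul_injective z)]
  refine ⟨h.1, fun ν hν hne => ?_⟩
  obtain ⟨ν, hν', rfl⟩ := exists_coeff_ne_zero_of_mapDomain hν
  exact hr.mul_left _ _ _ (h.2 ν hν' (fun e => hne (by rw [e])))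

theorem IsLeading.mul_gen (hr : NF.IsMonomialOrder r) (z : X) {f : BC k X} {μ : NF X}
    (h : IsLeading r f μ) : IsLeading r (f * BC.gen z) (μ * NF.letter z) := by
  rw [IsLeading, BC.coeff_mul_gen, Finsupp.mapDomain_apply (NF.mul_letter_injective z)]
  refine ⟨h.1, fun ν hν hne => ?_⟩
  obtain ⟨ν, hν', rfl⟩ := exists_coeff_ne_zero_of_mapDomain hν
  exact hr.mul_right _ _ _ (h.2 ν hν' (fun e => hne (by rw [e])))

theorem IsLeading.unique (hr : NF.IsMonomialOrder r) {f : BC k X} {μ ν : NF X}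
    (h : IsLeading r f μ) (h' : IsLeading r f ν) : μ = ν := by
  have := hr.wellOrder
  by_contra hne
  exact asymm_of r (h.2 ν h'.1 (Ne.symm hne)) (h'.2 μ h.1 hne)

theorem exists_isLeading (hr : NF.IsMonomialOrder r) {f : BC k X} (hf : f ≠ 0) :
    ∃ μ, IsLeading r f μ := by
  classical
  have := hr.wellOrder
  let _ := linearOrderOfSTO r
  have hne : f.coeff.support.Nonempty := by
    rw [Finsupp.support_nonempty_iff]
    simpa using hf
  refine ⟨f.coeff.support.max' hne, Finsupp.mem_support_iff.mp (Finset.max'_mem _ _),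
    fun ν hν hne' => ?_⟩
  exact lt_of_le_of_ne (Finset.le_max' _ ν (Finsupp.mem_support_iff.mpr hν)) hne'

end Leading

/-! ### Weights compatible with finitely many leading monomials -/

section Weight

variable {k : Type*} [Field k] {X : Type*} {r : NF X → NF X → Prop}

namespace NF

/-- The weight of a normal form that is given by an additive function of exponent vectors. -/
noncomputable def wt (f : (X → ℤ) × (X → ℤ) →+ ℤ) (μ : NF X) : ℤ := max (f μ.expL) (f μ.expR)

variable {f : (X → ℤ) × (X → ℤ) →+ ℤ}

theorem IsPair.wt_eq {μ : NF X} (h : μ.IsPair) : wt f μ = f μ.expL := by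
  rw [wt, h.expR_eq, max_self]

theorem wt_mul_letter_le (μ : NF X) (z : X) : wt f (μ * letter z) ≤ wt f μ + f (0, cnt {z}) := by
  rw [(isPair_mul _ _).wt_eq, expL_mul_letter, map_add]
  gcongr
  exact le_max_left _ _

theorem wt_letter_mul_le (z : X) (μ : NF X) : wt f (letter z * μ) ≤ wt f μ + f (cnt {z}, 0) := by
  rw [(isPair_mul _ _).wt_eq, expL_letter_mul, map_add, add_comm]
  gcongr
  exact le_max_right _ _

theorem IsPair.wt_mul_letter {μ : NF X} (h : μ.IsPair) (z : X) :
    wt f (μ * letter z) = wt f μ + f (0, cnt {z}) := by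
  rw [(isPair_mul _ _).wt_eq, expL_mul_letter, map_add, h.wt_eq]

theorem IsPair.wt_letter_mul {μ : NF X} (h : μ.IsPair) (z : X) :
    wt f (letter z * μ) = wt f μ + f (cnt {z}, 0) := by
  rw [(isPair_mul _ _).wt_eq, expL_letter_mul, map_add, h.wt_eq, h.expR_eq, add_comm]

theorem wt_pair (u v : Multiset X) (hu : u ≠ 0) (hv : v ≠ 0) :
    wt f (pair u v hu hv) = f (cnt u, 0) + f (0, cnt v) := by
  rw [IsPair.wt_eq (μ := pair u v hu hv) trivial, ← map_add]
  simp [expL]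

theorem card_mul_le_of_cnt (g : Multiset X →+ ℤ) {a : ℤ} (h : ∀ z, a ≤ g {z}) (u : Multiset X) :
    u.card * a ≤ g u := by
  induction u using Multiset.induction_on with
  | empty => simp
  | cons z u ih =>
    rw [Multiset.card_cons, ← Multiset.singleton_add, map_add]
    have := h z
    push_cast
    linarith

theorem le_card_mul_of_cnt (g : Multiset X →+ ℤ) {a : ℤ} (h : ∀ z, g {z} ≤ a) (u : Multiset X) :
    g u ≤ u.card * a := by
  induction u using Multiset.induction_on with
  | empty => simp
  | cons z u ih =>
    rw [Multiset.card_cons, ← Multiset.singleton_add, map_add]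
    have := h z
    push_cast
    linarith

theorem length_le_wt (hl : ∀ z, 0 < f (cnt {z}, 0)) (hr : ∀ z, 0 < f (0, cnt {z})) (μ : NF X) :
    (μ.length : ℤ) ≤ wt f μ := by
  cases μ with
  | letter z => exact le_trans (by have := hl z; simp only [length, expL]; omega) (le_max_left _ _)
  | pair u v hu hv =>
    have h1 := card_mul_le_of_cnt (f.comp ((AddMonoidHom.inl _ _).comp cnt)) (a := 1) hl u
    have h2 := card_mul_le_of_cnt (f.comp ((AddMonoidHom.inr _ _).comp cnt)) (a := 1) hr v
    rw [wt_pair, length]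
    simp at h1 h2
    push_cast
    linarith

theorem wt_le_length_mul {K : ℤ} (hl : ∀ z, f (cnt {z}, 0) ≤ K) (hr : ∀ z, f (0, cnt {z}) ≤ K)
    (μ : NF X) : wt f μ ≤ μ.length * K := by
  cases μ with
  | letter z => simpa [wt, expL, expR, length] using ⟨hl z, hr z⟩
  | pair u v hu hv =>
    have h1 := le_card_mul_of_cnt (f.comp ((AddMonoidHom.inl _ _).comp cnt)) hl u
    have h2 := le_card_mul_of_cnt (f.comp ((AddMonoidHom.inr _ _).comp cnt)) hr v
    rw [wt_pair, length]
    simp at h1 h2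
    push_cast
    linarith

end NF

/-- Finitely many polynomials have a positive weight for which their leading monomials have
maximal weight. -/
theorem exists_weight [Finite X] (hr : NF.IsMonomialOrder r) {M : Set (NF X)} (hM : M.Finite)
    (hpair : ∀ μ ∈ M, μ.IsPair) (s : NF X → BC k X) (hs : ∀ μ ∈ M, IsLeading r (s μ) μ) :
    ∃ f : (X → ℤ) × (X → ℤ) →+ ℤ, (∀ z, 0 < f (NF.cnt {z}, 0)) ∧ (∀ z, 0 < f (0, NF.cnt {z})) ∧
      ∀ μ ∈ M, ∀ ν, (s μ).coeff ν ≠ 0 → NF.wt f ν ≤ NF.wt f μ := by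
  let T : NF X → Set (NF X) := fun μ => {ν | ν ∈ ((s μ).coeff.support : Set (NF X)) ∧ ν ≠ μ}
  have hT : ∀ μ, (T μ).Finite := fun μ => (s μ).coeff.support.finite_toSet.subset fun ν h => h.1
  -- Both exponent vectors of ν enter because the weight is their maximum; the unit vectors make the
  -- weights of letters positive.
  let D : Set ((X → ℤ) × (X → ℤ)) :=
    ((⋃ μ ∈ M, (fun ν => μ.expL - ν.expL) '' T μ) ∪ (⋃ μ ∈ M, (fun ν => μ.expL - ν.expR) '' T μ)) ∪
      (Set.range (fun z => (NF.cnt {z}, 0)) ∪ Set.range (fun z => (0, NF.cnt {z})))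
  have hD : D.Finite :=
    ((hM.biUnion fun μ _ => (hT μ).image _).union (hM.biUnion fun μ _ => (hT μ).image _)).union
      ((Set.finite_range _).union (Set.finite_range _))
  have hlt : ∀ μ ∈ M, ∀ ν ∈ T μ, r ν μ := fun μ hμ ν hν =>
    (hs μ hμ).2 ν (Finsupp.mem_support_iff.mp hν.1) hν.2
  have hDP : D ⊆ NF.posCone r := by
    rintro a ((ha | ha) | (⟨z, rfl⟩ | ⟨z, rfl⟩))
    · simp only [Set.mem_iUnion] at ha
      obtain ⟨μ, hμ, ν, hν, rfl⟩ := ha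
      exact hr.sub_expL_mem (hpair μ hμ) (hlt μ hμ ν hν)
    · simp only [Set.mem_iUnion] at ha
      obtain ⟨μ, hμ, ν, hν, rfl⟩ := ha
      exact hr.sub_expR_mem (hpair μ hμ) (hlt μ hμ ν hν)
    · exact hr.cnt_left_mem z
    · exact hr.cnt_right_mem z
  obtain ⟨f, hf⟩ := hr.exists_pos hD hDP
  refine ⟨f, fun z => hf _ (.inr (.inl ⟨z, rfl⟩)), fun z => hf _ (.inr (.inr ⟨z, rfl⟩)),
    fun μ hμ ν hν => ?_⟩
  by_cases e : ν = μ
  · rw [e]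
  have hν' : ν ∈ T μ := ⟨Finsupp.mem_support_iff.mpr hν, e⟩
  have h1 := hf (μ.expL - ν.expL) (.inl (.inl (Set.mem_biUnion hμ ⟨ν, hν', rfl⟩)))
  have h2 := hf (μ.expL - ν.expR) (.inl (.inr (Set.mem_biUnion hμ ⟨ν, hν', rfl⟩)))
  rw [map_sub] at h1 h2
  rw [(hpair μ hμ).wt_eq]
  exact max_le (by linarith) (by linarith)

end Weight

/-! ### Irreducible pairs and reduction -/

section Reduction

variable {k : Type*} [Field k] {X : Type*} {A : Type*} [NonUnitalNonAssocRing A] [Module k A]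

theorem BC.map_eq_sum (φ : BC k X →ₙₐ[k] A) (f : BC k X) :
    φ f = ∑ μ ∈ f.coeff.support, f.coeff μ • φ (BC.mono μ) := by
  conv_lhs => rw [← MonoidAlgebra.sum_coeff_single f, Finsupp.sum, map_sum]
  refine Finset.sum_congr rfl fun μ _ => ?_
  rw [← map_smul]
  simp [BC.mono]

/-- `M` is a finite set of leading monomials of elements of the kernel of `φ` that generates, with
respect to divisibility, all those leading monomials of elements of the kernel that are not
letters. -/
structure IsLeadBasis (r : NF X → NF X → Prop) (φ : BC k X →ₙₐ[k] A) (M : Set (NF X)) : Prop where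
  finite : M.Finite
  isPair : ∀ μ ∈ M, μ.IsPair
  exists_lead : ∀ μ ∈ M, ∃ s, φ s = 0 ∧ IsLeading r s μ
  divides : ∀ f μ, φ f = 0 → IsLeading r f μ → μ.IsPair → ∃ ν ∈ M, ν.Divides μ

/-- The pairs that are not divisible by an element of `M`. -/
def irrPairs (M : Set (NF X)) : Set (NF X) := {μ | μ.IsPair ∧ ∀ ν ∈ M, ¬ ν.Divides μ}

variable {r : NF X → NF X → Prop} {φ : BC k X →ₙₐ[k] A} {M : Set (NF X)}

/-- A nontrivial relation would be a nonzero element of the kernel whose leading monomial is an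
irreducible pair, although it must be divisible by an element of M. -/
theorem IsLeadBasis.linearIndepOn (hr : NF.IsMonomialOrder r) (hM : IsLeadBasis r φ M) :
    LinearIndepOn k (fun μ => φ (BC.mono μ)) (irrPairs M) := by
  rw [linearIndepOn_iff]
  intro l hl h0
  have h1 : φ (MonoidAlgebra.ofCoeff l) = 0 := by
    rw [← h0, Finsupp.linearCombination_apply, BC.map_eq_sum]
    rfl
  by_contra hne
  obtain ⟨μ, hμ⟩ := exists_isLeading (k := k) hr (f := MonoidAlgebra.ofCoeff l) (by simpa using hne)
  have hμ' : μ ∈ irrPairs M := hl (Finsupp.mem_support_iff.mpr hμ.1)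
  obtain ⟨ν, hν, hd⟩ := hM.divides _ _ h1 hμ hμ'.1
  exact hμ'.2 ν hν hd

/-- Maximality of the weight at the leading monomial passes from the finitely many chosen
polynomials to all their multiples: a letter raises the weight of a pair by a fixed amount, and that
of any other monomial by at most this amount. -/
theorem IsLeadBasis.exists_reduction [Finite X] (hr : NF.IsMonomialOrder r)
    (hM : IsLeadBasis r φ M) :
    ∃ f : (X → ℤ) × (X → ℤ) →+ ℤ, (∀ z, 0 < f (NF.cnt {z}, 0)) ∧ (∀ z, 0 < f (0, NF.cnt {z})) ∧
      ∀ μ : NF X, μ.IsPair → μ ∉ irrPairs M → ∃ h : BC k X, φ h = 0 ∧ IsLeading r h μ ∧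
        ∀ ν, h.coeff ν ≠ 0 → NF.wt f ν ≤ NF.wt f μ := by
  have h := hM.exists_lead
  choose! s hs0 hs using h
  obtain ⟨f, hl, hr', hf⟩ := exists_weight hr hM.finite hM.isPair s hs
  refine ⟨f, hl, hr', fun μ hμ hirr => ?_⟩
  obtain ⟨μ₀, hμ₀, hd⟩ : ∃ ν ∈ M, ν.Divides μ := by
    by_contra! hc
    exact hirr ⟨hμ, hc⟩
  refine NF.divides_induction (P := fun μ => ∃ h : BC k X, φ h = 0 ∧ IsLeading r h μ ∧
    ∀ ν, h.coeff ν ≠ 0 → NF.wt f ν ≤ NF.wt f μ) (hM.isPair _ hμ₀) ⟨s μ₀, hs0 _ hμ₀, hs _ hμ₀, hf _ hμ₀⟩ ?_ ?_ hd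
  · rintro z ν hν ⟨h, h0, hlead, hw⟩
    refine ⟨BC.gen z * h, by rw [map_mul, h0, mul_zero], hlead.gen_mul hr z, fun ρ hρ => ?_⟩
    rw [BC.coeff_gen_mul] at hρ
    obtain ⟨ρ, hρ', rfl⟩ := exists_coeff_ne_zero_of_mapDomain hρ
    rw [hν.wt_letter_mul]
    exact (NF.wt_letter_mul_le z ρ).trans (by gcongr; exact hw ρ hρ')
  · rintro z ν hν ⟨h, h0, hlead, hw⟩
    refine ⟨h * BC.gen z, by rw [map_mul, h0, zero_mul], hlead.mul_gen hr z, fun ρ hρ => ?_⟩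
    rw [BC.coeff_mul_gen] at hρ
    obtain ⟨ρ, hρ', rfl⟩ := exists_coeff_ne_zero_of_mapDomain hρ
    rw [hν.wt_mul_letter]
    exact (NF.wt_mul_letter_le ρ z).trans (by gcongr; exact hw ρ hρ')

/-- The image of the span of the normal forms of length at most `n`. -/
def lengthLE (φ : BC k X →ₙₐ[k] A) (n : ℕ) : Submodule k A :=
  Submodule.span k ((fun μ => φ (BC.mono μ)) '' {μ | μ.length ≤ n})

/-- Here K bounds the weights of the letters in either position, so that length ≤ weight ≤ K ·
length. Reduction does not increase weight, hence it multiplies length by at most K. -/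
theorem IsLeadBasis.exists_lengthLE_le [Finite X] (hr : NF.IsMonomialOrder r)
    (hM : IsLeadBasis r φ M) :
    ∃ K : ℕ, ∀ n, lengthLE φ n ≤ Submodule.span k ((fun μ => φ (BC.mono μ)) ''
      (Set.range NF.letter ∪ {μ ∈ irrPairs M | μ.length ≤ K * n})) := by
  obtain ⟨f, hl, hr', hf⟩ := hM.exists_reduction hr
  obtain ⟨K, hK⟩ : ∃ K : ℕ, ∀ z, f (NF.cnt {z}, 0) ≤ K ∧ f (0, NF.cnt {z}) ≤ K := by
    have := Fintype.ofFinite X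
    refine ⟨∑ z, ((f (NF.cnt {z}, 0)).toNat + (f (0, NF.cnt {z})).toNat), fun z => ?_⟩
    have := Finset.single_le_sum
      (f := fun z => ((f (NF.cnt {z}, 0)).toNat + (f (0, NF.cnt {z})).toNat))
      (fun _ _ => Nat.zero_le _) (Finset.mem_univ z)
    omega
  have key : ∀ μ : NF X, φ (BC.mono μ) ∈ Submodule.span k ((fun μ => φ (BC.mono μ)) ''
      (Set.range NF.letter ∪ {ν ∈ irrPairs M | NF.wt f ν ≤ NF.wt f μ})) := by
    intro μ
    have := hr.wellOrder
    induction μ using (IsWellFounded.wf (r := r)).induction with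
    | _ μ ih =>
      by_cases hμ : μ.IsPair
      swap
      · refine Submodule.subset_span ⟨μ, .inl ?_, rfl⟩
        cases μ with
        | letter z => exact ⟨z, rfl⟩
        | pair => exact (hμ trivial).elim
      by_cases hirr : μ ∈ irrPairs M
      · exact Submodule.subset_span ⟨μ, .inr ⟨hirr, le_rfl⟩, rfl⟩
      obtain ⟨h, h0, hlead, hw⟩ := hf μ hμ hirr
      -- Modulo the kernel, μ equals a combination of the smaller monomials of h, whose weights do
      -- not exceed that of μ.
      have e : h.coeff μ • BC.mono μ = h - h.erase μ := by
        rw [eq_sub_iff_add_eq]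
        simp [BC.mono]
      have e' : φ (BC.mono μ) = -((h.coeff μ)⁻¹ • φ (h.erase μ)) := by
        rw [← smul_neg, ← zero_sub, ← h0, ← map_sub, ← e, map_smul, inv_smul_smul₀ hlead.1]
      rw [e']
      refine Submodule.neg_mem _ (Submodule.smul_mem _ _ ?_)
      rw [BC.map_eq_sum]
      refine Submodule.sum_mem _ fun ν hν => ?_
      have hν' : ν ≠ μ ∧ h.coeff ν ≠ 0 := by
        classical
        rw [MonoidAlgebra.coeff_erase, Finsupp.support_erase, Finset.mem_erase,
          Finsupp.mem_support_iff] at hν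
        exact hν
      refine Submodule.smul_mem _ _ (Submodule.span_mono (Set.image_mono ?_)
        (ih ν (hlead.2 ν hν'.2 hν'.1)))
      exact Set.union_subset_union_right _ fun ρ hρ => ⟨hρ.1, hρ.2.trans (hw ν hν'.2)⟩
  refine ⟨K, fun n => Submodule.span_le.mpr ?_⟩
  rintro _ ⟨μ, hμ, rfl⟩
  refine Submodule.span_mono (Set.image_mono ?_) (key μ)
  refine Set.union_subset_union_right _ fun ρ hρ => ⟨hρ.1, ?_⟩
  have h1 := NF.length_le_wt hl hr' ρ
  have h2 := NF.wt_le_length_mul (fun z => (hK z).1) (fun z => (hK z).2) μ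
  have h3 : (μ.length : ℤ) * K ≤ n * K := by gcongr; exact hμ
  have : (ρ.length : ℤ) ≤ K * n := by linarith [hρ.2]
  exact_mod_cast this

end Reduction

/-! ### Polynomial growth and logarithms -/

section Growth

open Filter Topology

theorem tendsto_logb_const (C : ℝ) : Tendsto (fun n : ℕ => Real.logb n C) atTop (𝓝 0) := by
  simp only [Real.logb]
  exact (Real.tendsto_log_atTop.comp tendsto_natCast_atTop_atTop).const_div_atTop _

theorem limsup_logb_le {g : ℕ → ℕ} {C d : ℕ} (h : ∀ n, 1 ≤ n → g n ≤ C * n ^ d) :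
    limsup (fun n : ℕ => ((Real.logb n (g n) : ℝ) : EReal)) atTop ≤ (d : EReal) := by
  have ht : Tendsto (fun n : ℕ => ((Real.logb n ((C + 1 : ℕ) : ℝ) + d : ℝ) : EReal)) atTop
      (𝓝 ((0 + d : ℝ) : EReal)) :=
    (continuous_coe_real_ereal.tendsto _).comp ((tendsto_logb_const _).add_const _)
  have e : ((0 + d : ℝ) : EReal) = (d : EReal) := by rw [zero_add]; rfl
  rw [← e, ← ht.limsup_eq]
  refine limsup_le_limsup ?_
  filter_upwards [eventually_ge_atTop 2] with n hn
  have hn1 : (1 : ℝ) < n := by exact_mod_cast hn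
  -- Using C + 1 in place of C keeps the bound nonnegative, which also covers g n = 0, where the
  -- logarithm is 0 by convention.
  have hC : 0 ≤ Real.logb n ((C + 1 : ℕ) : ℝ) :=
    Real.logb_nonneg hn1 (by push_cast; linarith [Nat.cast_nonneg (α := ℝ) C])
  refine EReal.coe_le_coe_iff.mpr ?_
  rcases Nat.eq_zero_or_pos (g n) with h0 | h0
  · rw [h0]
    simp only [Nat.cast_zero, Real.logb_zero]
    positivity
  · have h1 : (g n : ℝ) ≤ ((C + 1 : ℕ) : ℝ) * (n : ℝ) ^ d := by
      exact_mod_cast (h n (by omega)).trans (Nat.mul_le_mul_right _ (Nat.le_succ C))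
    calc Real.logb n (g n) ≤ Real.logb n (((C + 1 : ℕ) : ℝ) * (n : ℝ) ^ d) :=
          Real.logb_le_logb_of_le hn1 (by exact_mod_cast h0) h1
      _ = Real.logb n ((C + 1 : ℕ) : ℝ) + d := by
          rw [Real.logb_mul (by positivity) (by positivity), Real.logb_pow,
            Real.logb_self_eq_one hn1, mul_one]

theorem le_limsup_logb {g : ℕ → ℕ} {C d : ℕ} (hC : 0 < C)
    (h : ∀ᶠ n in atTop, n ^ d ≤ C * g n) :
    (d : EReal) ≤ limsup (fun n : ℕ => ((Real.logb n (g n) : ℝ) : EReal)) atTop := by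
  have ht : Tendsto (fun n : ℕ => ((-Real.logb n (C : ℝ) + d : ℝ) : EReal)) atTop
      (𝓝 ((-0 + d : ℝ) : EReal)) :=
    (continuous_coe_real_ereal.tendsto _).comp ((tendsto_logb_const _).neg.add_const _)
  have e : ((-0 + d : ℝ) : EReal) = (d : EReal) := by rw [neg_zero, zero_add]; rfl
  rw [← e, ← ht.limsup_eq]
  refine limsup_le_limsup ?_
  filter_upwards [eventually_ge_atTop 2, h] with n hn hg
  have hn1 : (1 : ℝ) < n := by exact_mod_cast hn
  refine EReal.coe_le_coe_iff.mpr ?_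
  have hpos : 0 < C * g n := lt_of_lt_of_le (by positivity) hg
  have hg0 : 0 < g n := Nat.pos_of_mul_pos_left hpos
  have hC' : (C : ℝ) ≠ 0 := by positivity
  have hg' : (g n : ℝ) ≠ 0 := by positivity
  have h1 : Real.logb n ((n : ℝ) ^ d) ≤ Real.logb n (C * g n) :=
    Real.logb_le_logb_of_le hn1 (by positivity) (by exact_mod_cast hg)
  rw [Real.logb_mul hC' hg', Real.logb_pow, Real.logb_self_eq_one hn1, mul_one] at h1
  linarith

end Growth

/-! ### Powers of subspaces compared with the length filtration -/

section Powers

variable {k : Type*} [Field k] {X : Type*} {A : Type*} [NonUnitalNonAssocRing A] [Module k A]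

theorem mulSpan_le {V W U : Submodule k A} : mulSpan V W ≤ U ↔ ∀ x ∈ V, ∀ y ∈ W, x * y ∈ U := by
  rw [mulSpan, Submodule.span_le]
  exact ⟨fun h x hx y hy => h ⟨x, hx, y, hy, rfl⟩, fun h _ ⟨x, hx, y, hy, e⟩ => e ▸ h x hx y hy⟩

theorem powSpan_add_two (V : Submodule k A) (n : ℕ) : powSpan V (n + 2) =
    ⨆ i : Fin (n + 1), mulSpan (powSpan V ((i : ℕ) + 1)) (powSpan V (n + 1 - (i : ℕ))) := by
  rw [powSpan]

theorem powSpan_one (V : Submodule k A) : powSpan V 1 = V := by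
  rw [powSpan]

theorem mul_mem_powSpan {V : Submodule k A} {m n : ℕ} (hm : 1 ≤ m) (hn : 1 ≤ n) {x y : A}
    (hx : x ∈ powSpan V m) (hy : y ∈ powSpan V n) : x * y ∈ powSpan V (m + n) := by
  obtain ⟨m, rfl⟩ := Nat.exists_eq_add_of_le' hm
  obtain ⟨n, rfl⟩ := Nat.exists_eq_add_of_le' hn
  rw [show m + 1 + (n + 1) = m + n + 2 by omega, powSpan_add_two]
  refine Submodule.mem_iSup_of_mem (⟨m, by omega⟩ : Fin (m + n + 1)) ?_
  refine Submodule.subset_span ⟨x, hx, y, ?_, rfl⟩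
  rwa [show m + n + 1 - m = n + 1 by omega]

theorem powLE_le {V U : Submodule k A} {n : ℕ} :
    powLE V n ≤ U ↔ ∀ i, 1 ≤ i → i ≤ n → powSpan V i ≤ U := by
  simp only [powLE, iSup_le_iff, Finset.mem_Icc, and_imp]

theorem powSpan_le_powLE (V : Submodule k A) {i n : ℕ} (hi : 1 ≤ i) (hn : i ≤ n) :
    powSpan V i ≤ powLE V n :=
  powLE_le.mp le_rfl i hi hn

variable {φ : BC k X →ₙₐ[k] A}

theorem lengthLE_mono {m n : ℕ} (h : m ≤ n) : lengthLE φ m ≤ lengthLE φ n :=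
  Submodule.span_mono (Set.image_mono fun _ hμ => le_trans hμ h)

theorem BC.mono_mul (μ ν : NF X) : (BC.mono (μ * ν) : BC k X) = BC.mono μ * BC.mono ν := by
  simp [BC.mono, MonoidAlgebra.single_mul_single]

theorem mul_mem_lengthLE [IsScalarTower k A A] [SMulCommClass k A A] {m n : ℕ} {x y : A}
    (hx : x ∈ lengthLE φ m) (hy : y ∈ lengthLE φ n) : x * y ∈ lengthLE φ (m + n) := by
  have h := Submodule.apply_mem_map₂ (LinearMap.mul k A) hx hy
  rw [lengthLE, lengthLE, Submodule.map₂_span_span] at h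
  refine Submodule.span_mono ?_ h
  rintro _ ⟨_, ⟨μ, hμ, rfl⟩, _, ⟨ν, hν, rfl⟩, rfl⟩
  refine ⟨μ * ν, ?_, by simp [BC.mono_mul]⟩
  rw [Set.mem_ofPred_eq, NF.length_mul]
  exact add_le_add hμ hν

theorem powSpan_le_lengthLE [IsScalarTower k A A] [SMulCommClass k A A] {V : Submodule k A} {m : ℕ}
    (hV : V ≤ lengthLE φ m) (n : ℕ) : powSpan V n ≤ lengthLE φ (m * n) := by
  induction n using Nat.strong_induction_on with
  | _ n ih =>
    match n with
    | 0 => rw [powSpan]; exact bot_le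
    | 1 => simpa [powSpan_one] using hV
    | n + 2 =>
      rw [powSpan_add_two]
      refine iSup_le fun i => mulSpan_le.mpr fun x hx y hy => ?_
      have h := mul_mem_lengthLE (ih _ (by omega) hx) (ih _ (by omega) hy)
      rwa [← mul_add, show (i : ℕ) + 1 + (n + 1 - i) = n + 2 by omega] at h

theorem powLE_le_lengthLE [IsScalarTower k A A] [SMulCommClass k A A] {V : Submodule k A} {m : ℕ}
    (hV : V ≤ lengthLE φ m) (n : ℕ) : powLE V n ≤ lengthLE φ (m * n) :=
  powLE_le.mpr fun i _ hi => (powSpan_le_lengthLE hV i).trans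
    (lengthLE_mono (Nat.mul_le_mul_left m hi))

theorem mem_powSpan_lengthLE_one (μ : NF X) :
    φ (BC.mono μ) ∈ powSpan (lengthLE φ 1) μ.length := by
  have hl : ∀ x, φ (BC.mono (NF.letter x)) ∈ powSpan (lengthLE φ 1) 1 := fun x => by
    rw [powSpan_one]
    exact Submodule.subset_span ⟨_, le_refl 1, rfl⟩
  induction μ using NF.induction_mul with
  | hl x => exact hl x
  | h1 x μ ih =>
    rw [BC.mono_mul, map_mul, NF.length_mul]
    exact mul_mem_powSpan le_rfl μ.one_le_length (hl x) ih
  | h2 x μ ih =>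
    rw [BC.mono_mul, map_mul, NF.length_mul]
    exact mul_mem_powSpan μ.one_le_length le_rfl ih (hl x)

theorem lengthLE_le_powLE (n : ℕ) : lengthLE φ n ≤ powLE (lengthLE φ 1) n := by
  refine Submodule.span_le.mpr ?_
  rintro _ ⟨μ, hμ, rfl⟩
  exact powSpan_le_powLE _ μ.one_le_length hμ (mem_powSpan_lengthLE_one μ)

/-- With `powLE_le_lengthLE`, this reduces the supremum over all V to the growth of the length
filtration: V^{≤ n} lies in `lengthLE φ (m * n)`. -/
theorem exists_le_lengthLE (hφ : Function.Surjective φ) (V : Submodule k A)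
    [FiniteDimensional k V] : ∃ m, V ≤ lengthLE φ m := by
  have hx : ∀ x : A, ∃ m, x ∈ lengthLE φ m := by
    intro x
    obtain ⟨f, rfl⟩ := hφ x
    refine ⟨f.coeff.support.sup NF.length, ?_⟩
    rw [BC.map_eq_sum]
    refine Submodule.sum_mem _ fun μ hμ => ?_
    exact Submodule.smul_mem _ _ (Submodule.subset_span ⟨μ, Finset.le_sup (f := NF.length) hμ, rfl⟩)
  choose m hm using hx
  obtain ⟨s, hs⟩ := (Module.Finite.iff_fg.mp ‹FiniteDimensional k V› : V.FG)
  refine ⟨s.sup m, ?_⟩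
  rw [← hs, Submodule.span_le]
  exact fun x hx => lengthLE_mono (Finset.le_sup hx) (hm x)

end Powers

/-! ### Counting pairs with few large exponents -/

section Counting

/-- The number of exponent vectors with at most `d` exponents above `N`, and all exponents at most
`L`, is bounded by a polynomial in `L` of degree `d`. -/
theorem exists_finset_of_card_filter_le (J : Type*) [Fintype J] (N d L : ℕ) :
    ∃ T : Finset (J → ℕ), T.card ≤ 2 ^ Fintype.card J * ((N + 1) ^ Fintype.card J * (L + 1) ^ d) ∧
      ∀ a : J → ℕ, (∀ j, a j ≤ L) → (Finset.univ.filter fun j => N < a j).card ≤ d → a ∈ T := by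
  classical
  -- I ranges over the possible sets of coordinates allowed to exceed N. Each such box has at most
  -- (N + 1)^|J| (L + 1)^d points.
  refine ⟨(Finset.univ.filter fun I : Finset J => I.card ≤ d).biUnion fun I =>
    Fintype.piFinset fun j => Finset.range (if j ∈ I then L + 1 else N + 1), ?_, fun a ha hd => ?_⟩
  · refine (Finset.card_biUnion_le_card_mul _ _ ((N + 1) ^ Fintype.card J * (L + 1) ^ d)
      fun I hI => ?_).trans (Nat.mul_le_mul_right _ ?_)
    · rw [Fintype.card_piFinset]
      simp only [Finset.card_range]
      rw [Finset.prod_ite]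
      simp only [Finset.prod_const]
      rw [mul_comm]
      refine Nat.mul_le_mul (Nat.pow_le_pow_right (by omega) (Finset.card_le_univ _))
        (Nat.pow_le_pow_right (by omega) ?_)
      simpa using hI
    · exact (Finset.card_filter_le _ _).trans (by simp)
  · refine Finset.mem_biUnion.mpr ⟨Finset.univ.filter fun j => N < a j, by simpa using hd, ?_⟩
    refine Fintype.mem_piFinset.mpr fun j => Finset.mem_range.mpr ?_
    have := ha j
    by_cases hj : N < a j
    · simp [hj]; omega
    · simp [hj]; omega

variable {X : Type*}

open Classical in
/-- The exponents of a pair `[u;v]`. -/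
noncomputable def NF.exponent : NF X → X ⊕ X → ℕ
  | NF.letter _, _ => 0
  | NF.pair u _ _ _, .inl x => u.count x
  | NF.pair _ v _ _, .inr x => v.count x

theorem NF.exponent_injOn : Set.InjOn (NF.exponent (X := X)) {μ | μ.IsPair} := by
  classical
  intro μ hμ ν hν h
  cases μ with
  | letter x => exact hμ.elim
  | pair u v hu hv =>
    cases ν with
    | letter x => exact hν.elim
    | pair u' v' hu' hv' =>
      have h1 : u = u' := Multiset.ext.mpr fun x => congrFun h (.inl x)
      have h2 : v = v' := Multiset.ext.mpr fun x => congrFun h (.inr x)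
      subst h1 h2
      rfl

theorem NF.exponent_le_length (μ : NF X) (j : X ⊕ X) : μ.exponent j ≤ μ.length := by
  classical
  cases μ with
  | letter x => exact Nat.zero_le _
  | pair u v hu hv =>
    cases j with
    | inl x => exact (Multiset.count_le_card x u).trans (Nat.le_add_right _ _)
    | inr x => exact (Multiset.count_le_card x v).trans (Nat.le_add_left _ _)

theorem NF.IsPair.divides_iff {μ ν : NF X} (hμ : μ.IsPair) (hν : ν.IsPair) :
    μ.Divides ν ↔ ∀ j, μ.exponent j ≤ ν.exponent j := by
  classical
  cases μ with
  | letter x => exact hμ.elim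
  | pair u v hu hv =>
    cases ν with
    | letter x => exact hν.elim
    | pair u' v' hu' hv' =>
      simp only [NF.Divides, Sum.forall, Multiset.le_iff_count, NF.exponent]

variable [Fintype X]

theorem Sd_eq_card (N : ℕ) (μ : NF X) :
    Sd N μ = (Finset.univ.filter fun j => N < μ.exponent j).card := by
  classical
  cases μ with
  | letter x => simp [Sd, NF.exponent]
  | pair u v hu hv =>
    rw [Sd, Finset.card_filter _ (Finset.univ : Finset (X ⊕ X)), Fintype.sum_sum_type,
      ← Finset.card_filter, ← Finset.card_filter]
    rfl

theorem finite_ncard_pairs_le (N d L : ℕ) (Q : Set (NF X)) (hQ : ∀ μ ∈ Q, μ.IsPair)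
    (hd : ∀ μ ∈ Q, Sd N μ ≤ d) (hL : ∀ μ ∈ Q, μ.length ≤ L) :
    Q.Finite ∧ Q.ncard ≤ 2 ^ Fintype.card (X ⊕ X) *
      ((N + 1) ^ Fintype.card (X ⊕ X) * (L + 1) ^ d) := by
  obtain ⟨T, hT, hmem⟩ := exists_finset_of_card_filter_le (X ⊕ X) N d L
  have hmaps : Set.MapsTo NF.exponent Q (T : Set (X ⊕ X → ℕ)) := fun μ hμ =>
    hmem _ (fun j => (μ.exponent_le_length j).trans (hL μ hμ)) (Sd_eq_card N μ ▸ hd μ hμ)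
  have hinj := NF.exponent_injOn.mono hQ
  refine ⟨Set.Finite.of_injOn hmaps hinj T.finite_toSet, ?_⟩
  refine (Set.ncard_le_ncard_of_injOn _ hmaps hinj T.finite_toSet).trans ?_
  rwa [Set.ncard_coe_finset]

theorem Sd_le (N : ℕ) (μ : NF X) : Sd N μ ≤ Fintype.card (X ⊕ X) :=
  Sd_eq_card N μ ▸ Finset.card_le_univ _

theorem finite_setOf_length_le (n : ℕ) : {μ : NF X | μ.length ≤ n}.Finite := by
  refine ((Set.finite_range NF.letter).union (finite_ncard_pairs_le 0 _ n
    {μ : NF X | μ.IsPair ∧ μ.length ≤ n} (fun μ h => h.1) (fun μ _ => Sd_le 0 μ)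
    (fun μ h => h.2)).1).subset fun μ hμ => ?_
  cases μ with
  | letter x => exact .inl ⟨x, rfl⟩
  | pair => exact .inr ⟨trivial, hμ⟩

end Counting

open Filter

/-! ### The dimension formula -/

section Core

variable {k : Type*} [Field k] {X : Type*} [Fintype X] {A : Type*} [NonUnitalNonAssocRing A]
  [Module k A] {r : NF X → NF X → Prop} {φ : BC k X →ₙₐ[k] A} {M : Set (NF X)}

/-- The multiples of a pair by arbitrary powers of those variables that have a large exponent. -/
theorem exists_finset_irrPairs {N : ℕ} (hM : ∀ μ ∈ M, μ.IsPair)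
    (hN : ∀ μ ∈ M, ∀ j, μ.exponent j ≤ N) {μ : NF X} (hμ : μ ∈ irrPairs M) (m : ℕ) :
    ∃ T : Finset (NF X), (T : Set (NF X)) ⊆ irrPairs M ∧
      (∀ ν ∈ T, ν.length ≤ μ.length + Fintype.card (X ⊕ X) * m) ∧ T.card = (m + 1) ^ Sd N μ := by
  classical
  obtain ⟨hp, hirr⟩ := hμ
  cases μ with
  | letter x => exact hp.elim
  | pair u v hu hv =>
    set μ := NF.pair u v hu hv with hμ
    let g : (X ⊕ X → ℕ) → NF X := fun c =>
      NF.pair (u + ∑ x, c (.inl x) • {x}) (v + ∑ x, c (.inr x) • {x})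
        (by simp [hu]) (by simp [hv])
    have hg : ∀ c j, (g c).exponent j = μ.exponent j + c j := by
      rintro c (x | x) <;> simp [g, hμ, NF.exponent, Multiset.count_sum', Multiset.count_singleton]
    have hinj : Function.Injective g := fun c c' h => by
      ext j
      have h1 := hg c j
      rw [h, hg c' j] at h1
      omega
    let B : Finset (X ⊕ X → ℕ) := Fintype.piFinset fun j =>
      Finset.range (if N < μ.exponent j then m + 1 else 1)
    refine ⟨B.image g, ?_, ?_, ?_⟩
    · rintro _ hν
      obtain ⟨c, hc, rfl⟩ := Finset.mem_image.mp hν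
      refine ⟨trivial, fun ν hν hd => hirr ν hν ?_⟩
      rw [(hM ν hν).divides_iff (ν := g c) trivial] at hd
      rw [(hM ν hν).divides_iff (ν := μ) trivial]
      intro j
      have h1 := hd j
      rw [hg] at h1
      have h2 := Finset.mem_range.mp (Fintype.mem_piFinset.mp hc j)
      have h3 := hN ν hν j
      -- Where μ exceeds N, the exponent of ν is at most N and divisibility is automatic; elsewhere
      -- c j = 0 and nothing has changed.
      split_ifs at h2 with h <;> omega
    · intro ν hν
      obtain ⟨c, hc, rfl⟩ := Finset.mem_image.mp hν
      have hcm : ∀ j, c j ≤ m := fun j => by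
        have h2 := Finset.mem_range.mp (Fintype.mem_piFinset.mp hc j)
        split_ifs at h2 <;> omega
      have hl : (g c).length = μ.length + ∑ j, c j := by
        simp only [g, hμ, NF.length, Multiset.card_add, Multiset.card_sum, Multiset.card_nsmul,
          Multiset.card_singleton, mul_one, Fintype.sum_sum_type]
        omega
      rw [hl]
      gcongr
      exact (Finset.sum_le_card_nsmul _ _ m fun j _ => hcm j).trans (by simp)
    · rw [Finset.card_image_of_injective _ hinj, Fintype.card_piFinset, Sd_eq_card]
      simp only [Finset.card_range]
      rw [Finset.prod_ite]
      simp

instance finiteDimensional_lengthLE (n : ℕ) : FiniteDimensional k (lengthLE φ n) :=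
  FiniteDimensional.span_of_finite k ((finite_setOf_length_le n).image _)

theorem IsLeadBasis.card_le_finrank (hr : NF.IsMonomialOrder r) (hM : IsLeadBasis r φ M)
    {T : Finset (NF X)} (hT : (T : Set (NF X)) ⊆ irrPairs M) {n : ℕ}
    (hn : ∀ ν ∈ T, ν.length ≤ n) : T.card ≤ Module.finrank k (lengthLE φ n) := by
  have h := (hM.linearIndepOn hr).mono hT
  have h1 := finrank_span_eq_card (R := k) h
  simp only [Finset.coe_sort_coe, Fintype.card_coe] at h1
  rw [← h1]
  refine Submodule.finrank_mono (Submodule.span_le.mpr ?_)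
  rintro _ ⟨ν, rfl⟩
  exact Submodule.subset_span ⟨ν, hn ν ν.2, rfl⟩

theorem IsLeadBasis.exists_finrank_lengthLE_le (hr : NF.IsMonomialOrder r)
    (hM : IsLeadBasis r φ M) {N d : ℕ} (hd : ∀ μ ∈ irrPairs M, Sd N μ ≤ d) :
    ∃ C, ∀ n, 1 ≤ n → Module.finrank k (lengthLE φ n) ≤ C * n ^ d := by
  classical
  obtain ⟨K, hK⟩ := hM.exists_lengthLE_le hr
  set q := Fintype.card (X ⊕ X)
  refine ⟨Fintype.card X + 2 ^ q * ((N + 1) ^ q * (K + 1) ^ d), fun n hn => ?_⟩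
  obtain ⟨hfin, hcard⟩ := finite_ncard_pairs_le N d (K * n)
    {μ ∈ irrPairs M | μ.length ≤ K * n} (fun μ h => h.1.1) (fun μ h => hd μ h.1) (fun μ h => h.2)
  set Q := {μ ∈ irrPairs M | μ.length ≤ K * n}
  have hfin' : ((fun μ => φ (BC.mono μ)) '' (Set.range NF.letter ∪ Q)).Finite :=
    ((Set.finite_range _).union hfin).image _
  have := FiniteDimensional.span_of_finite k hfin'
  calc Module.finrank k (lengthLE φ n)
      ≤ Module.finrank k (Submodule.span k ((fun μ => φ (BC.mono μ)) ''
          (Set.range NF.letter ∪ Q))) := Submodule.finrank_mono (hK n)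
    _ ≤ ((fun μ => φ (BC.mono μ)) '' (Set.range NF.letter ∪ Q)).ncard := by
        have := hfin'.fintype
        rw [Set.ncard_eq_toFinset_card']
        exact finrank_span_le_card _
    _ ≤ (Set.range NF.letter ∪ Q).ncard := Set.ncard_image_le ((Set.finite_range _).union hfin)
    _ ≤ (Set.range (NF.letter (X := X))).ncard + Q.ncard := Set.ncard_union_le _ _
    _ ≤ Fintype.card X + 2 ^ q * ((N + 1) ^ q * (K * n + 1) ^ d) := by
        refine Nat.add_le_add ?_ hcard
        rw [← Set.image_univ]
        exact (Set.ncard_image_le Set.finite_univ).trans (by simp [Set.ncard_univ])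
    _ ≤ Fintype.card X * n ^ d + 2 ^ q * ((N + 1) ^ q * ((K + 1) * n) ^ d) := by
        have h1 : 1 ≤ n ^ d := Nat.one_le_pow _ _ hn
        refine Nat.add_le_add (Nat.le_mul_of_pos_right _ h1) ?_
        gcongr
        linarith
    _ = _ := by rw [mul_pow]; ring

/-- The supremum includes V = 0. This bound is needed when there are no irreducible pairs at all. -/
theorem GKdim_nonneg : 0 ≤ GKdim k A := by
  refine le_iSup₂_of_le (⊥ : Submodule k A) inferInstance ?_
  rw [← limsup_const (f := (atTop : Filter ℕ)) (0 : EReal)]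
  refine limsup_le_limsup ?_
  filter_upwards [eventually_ge_atTop 2] with n hn
  refine EReal.coe_nonneg.mpr ?_
  rcases Nat.eq_zero_or_pos (Module.finrank k (powLE (⊥ : Submodule k A) n)) with h | h
  · simp [h]
  · exact Real.logb_nonneg (by exact_mod_cast hn) (by exact_mod_cast h)

/-- The Gelfand-Kirillov dimension of a quotient of `BC(X)` is the largest number of exponents
above `N` in an irreducible pair, if `N` bounds the exponents in a basis of the leading pairs. -/
theorem IsLeadBasis.GKdim_eq [IsScalarTower k A A] [SMulCommClass k A A]
    (hr : NF.IsMonomialOrder r) (hM : IsLeadBasis r φ M) (hφ : Function.Surjective φ) {N d : ℕ}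
    (hN : ∀ μ ∈ M, ∀ j, μ.exponent j ≤ N) (hd : ∀ μ ∈ irrPairs M, Sd N μ ≤ d)
    (hd' : d = 0 ∨ ∃ μ ∈ irrPairs M, Sd N μ = d) : GKdim k A = (d : EReal) := by
  apply le_antisymm
  · refine iSup₂_le fun V hV => ?_
    obtain ⟨C, hC⟩ := hM.exists_finrank_lengthLE_le hr hd
    obtain ⟨m, hm⟩ := exists_le_lengthLE hφ V
    -- With m + 1 the length (m + 1) * n is positive, as the polynomial bound requires.
    have hm' : V ≤ lengthLE φ (m + 1) := hm.trans (lengthLE_mono (Nat.le_succ m))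
    refine limsup_logb_le (C := C * (m + 1) ^ d) fun n hn => ?_
    refine (Submodule.finrank_mono (powLE_le_lengthLE hm' n)).trans ((hC _ ?_).trans ?_)
    · exact Nat.mul_pos (Nat.succ_pos m) hn
    · rw [mul_pow, mul_assoc]
  · rcases hd' with rfl | ⟨μ, hμ, rfl⟩
    · exact_mod_cast GKdim_nonneg
    refine le_iSup₂_of_le (lengthLE φ 1) inferInstance ?_
    -- For m = n / c ≥ 1, raising the large exponents of μ by at most m gives lengths at most c * m
    -- ≤ n, while n ≤ c * (m + 1) compares the number (m + 1)^d of pairs with n^d.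
    set c := μ.length + Fintype.card (X ⊕ X) with hc
    have hc1 : 1 ≤ c := le_trans μ.one_le_length (Nat.le_add_right _ _)
    refine le_limsup_logb (C := c ^ Sd N μ) (by positivity) ?_
    filter_upwards [eventually_ge_atTop c] with n hn
    obtain ⟨T, hT, hlen, hcard⟩ := exists_finset_irrPairs hM.isPair hN hμ (n / c)
    have hm : 1 ≤ n / c := (Nat.one_le_div_iff hc1).mpr hn
    have h1 : n ≤ c * (n / c + 1) := (Nat.lt_mul_div_succ n hc1).le
    have h2 : T.card ≤ Module.finrank k (lengthLE φ n) := by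
      refine hM.card_le_finrank hr hT fun ν hν => (hlen ν hν).trans ?_
      calc μ.length + Fintype.card (X ⊕ X) * (n / c)
          ≤ μ.length * (n / c) + Fintype.card (X ⊕ X) * (n / c) := by gcongr; nlinarith
        _ = c * (n / c) := by rw [hc]; ring
        _ ≤ n := Nat.mul_div_le n c
    have h3 : Module.finrank k (lengthLE φ n) ≤ Module.finrank k (powLE (lengthLE φ 1) n) := by
      have h4 : powLE (lengthLE φ 1) n ≤ lengthLE φ (1 * n) := powLE_le_lengthLE le_rfl n
      have := Submodule.finiteDimensional_of_le h4
      exact Submodule.finrank_mono (lengthLE_le_powLE n)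
    calc n ^ Sd N μ ≤ (c * (n / c + 1)) ^ Sd N μ := Nat.pow_le_pow_left h1 _
      _ = c ^ Sd N μ * T.card := by rw [mul_pow, hcard]
      _ ≤ _ := Nat.mul_le_mul_left _ (h2.trans h3)

end Core

/-! ### Part (1): finite Gröbner–Shirshov bases -/

section Presentation

variable {k : Type*} [Field k] {X : Type*} {r : NF X → NF X → Prop}

/-- The quotient map as a homomorphism of algebras. -/
def AlgIdeal.Quotient.mkHom {A : Type*} [NonUnitalNonAssocRing A] [Module k A]
    (I : AlgIdeal k A) : A →ₙₐ[k] I.Quotient :=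
  { AlgIdeal.Quotient.mk I with
    map_smul' := (AlgIdeal.Quotient.mk I).map_smul'
    map_zero' := map_zero (AlgIdeal.Quotient.mk I)
    map_mul' := AlgIdeal.Quotient.mk_mul I }

theorem AlgIdeal.Quotient.mkHom_surjective {A : Type*} [NonUnitalNonAssocRing A] [Module k A]
    (I : AlgIdeal k A) : Function.Surjective (mkHom I) :=
  AlgIdeal.Quotient.mk_surjective I

theorem AlgIdeal.Quotient.mkHom_eq_zero {A : Type*} [NonUnitalNonAssocRing A] [Module k A]
    (I : AlgIdeal k A) {a : A} : mkHom I a = 0 ↔ a ∈ I.toSubmodule :=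
  Submodule.Quotient.mk_eq_zero I.toSubmodule

theorem AlgIdeal.subset_span {A : Type*} [NonUnitalNonAssocRing A] [Module k A]
    (S : Set A) : S ⊆ (AlgIdeal.span k S).toSubmodule := by
  intro s hs
  simp only [AlgIdeal.span, SetLike.mem_coe, Submodule.mem_iInf]
  exact fun I hI => hI hs

theorem IsLeading.foldl_mul_gen (hr : NF.IsMonomialOrder r) {f : BC k X} {μ : NF X}
    (h : IsLeading r f μ) (ys : List X) :
    IsLeading r (ys.foldl (fun f y => f * BC.gen y) f)
      (ys.foldl (fun ν y => ν * NF.letter y) μ) := by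
  induction ys generalizing f μ with
  | nil => exact h
  | cons y ys ih => exact ih (h.mul_gen hr y)

theorem IsLeading.foldr_gen_mul (hr : NF.IsMonomialOrder r) {f : BC k X} {μ : NF X}
    (h : IsLeading r f μ) (zs : List X) :
    IsLeading r (zs.foldr (fun z f => BC.gen z * f) f)
      (zs.foldr (fun z ν => NF.letter z * ν) μ) := by
  induction zs with
  | nil => exact h
  | cons z zs ih => exact ih.gen_mul hr z

theorem NF.foldl_pair_mul_letter (ys : List X) (u v : Multiset X) (hu : u ≠ 0) (hv : v ≠ 0) :
    ys.foldl (fun ν y => ν * letter y) (pair u v hu hv) = pair u (v + (ys : Multiset X)) hu (by simp [hv]) := by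
  induction ys generalizing v with
  | nil => simp
  | cons y ys ih =>
    rw [List.foldl_cons, pair_mul_letter, ih]
    simp [← Multiset.cons_coe]

theorem NF.foldr_letter_mul_pair (zs : List X) (u v : Multiset X) (hu : u ≠ 0) (hv : v ≠ 0) :
    zs.foldr (fun z ν => letter z * ν) (pair u v hu hv) = pair (u + (zs : Multiset X)) v (by simp [hu]) hv := by
  induction zs with
  | nil => simp
  | cons z zs ih =>
    rw [List.foldr_cons, ih, letter_mul_pair]
    simp [← Multiset.cons_coe]

/-- The pairs that are leading monomials of elements of `S`. -/
def leadPairs (r : NF X → NF X → Prop) (S : Set (BC k X)) : Set (NF X) :=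
  {μ | μ.IsPair ∧ ∃ s ∈ S, IsLeading r s μ}

theorem finite_setOf_isLeading (hr : NF.IsMonomialOrder r) {S : Set (BC k X)} (hS : S.Finite) :
    {μ | ∃ s ∈ S, IsLeading r s μ}.Finite := by
  refine (hS.biUnion (t := fun s => {μ | IsLeading r s μ}) fun s _ =>
    Set.Subsingleton.finite fun μ hμ ν hν => hμ.unique hr hν).subset ?_
  rintro μ ⟨s, hs, h⟩
  exact Set.mem_biUnion hs h

theorem leadPairs_finite (hr : NF.IsMonomialOrder r) {S : Set (BC k X)} (hS : S.Finite) :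
    (leadPairs r S).Finite :=
  (finite_setOf_isLeading hr hS).subset fun _ hμ => hμ.2

/-- A pair is the leading monomial of a normal `S`-polynomial if and only if it is divisible by the
leading pair of an element of `S`. -/
theorem exists_isNormalPoly_iff (hr : NF.IsMonomialOrder r) {S : Set (BC k X)} {μ : NF X}
    (hμ : μ.IsPair) :
    (∃ h, IsNormalPoly r S h ∧ IsLeading r h μ) ↔ ∃ ν ∈ leadPairs r S, ν.Divides μ := by
  constructor
  · rintro ⟨h, hS | ⟨s, hs, ν, hν, hlen, zs, ys, rfl⟩, hlead⟩
    · exact ⟨μ, ⟨hμ, h, hS, hlead⟩, NF.Divides.refl μ⟩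
    · have hp := NF.isPair_of_two_le_length hlen
      refine ⟨ν, ⟨hp, s, hs, hν⟩, ?_⟩
      rw [hlead.unique hr ((hν.foldl_mul_gen hr ys).foldr_gen_mul hr zs)]
      cases ν with
      | letter x => exact hp.elim
      | pair u v hu hv =>
        rw [NF.foldl_pair_mul_letter, NF.foldr_letter_mul_pair]
        exact ⟨Multiset.le_add_right _ _, Multiset.le_add_right _ _⟩
  · rintro ⟨ν, ⟨hp, s, hs, hν⟩, hd⟩
    have h2 := hp.two_le_length
    cases ν with
    | letter x => exact hp.elim
    | pair u v hu hv =>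
      cases μ with
      | letter x => exact hμ.elim
      | pair u' v' hu' hv' =>
        obtain ⟨a, rfl⟩ := Multiset.le_iff_exists_add.mp hd.1
        obtain ⟨b, rfl⟩ := Multiset.le_iff_exists_add.mp hd.2
        refine ⟨_, .inr ⟨s, hs, _, hν, h2, a.toList, b.toList, rfl⟩, ?_⟩
        have := (hν.foldl_mul_gen hr b.toList).foldr_gen_mul hr a.toList
        rw [NF.foldl_pair_mul_letter, NF.foldr_letter_mul_pair] at this
        simpa only [Multiset.coe_toList] using this

theorem mem_irrPairs_leadPairs (hr : NF.IsMonomialOrder r) {S : Set (BC k X)} {μ : NF X}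
    (hμ : μ.IsPair) : μ ∈ irrPairs (leadPairs r S) ↔ μ ∈ Irr r S := by
  have := exists_isNormalPoly_iff hr (S := S) hμ
  rw [Irr, Set.mem_ofPred_eq, this, irrPairs, Set.mem_ofPred_eq]
  push Not
  exact and_iff_right hμ

theorem IsGSB.isLeadBasis (hr : NF.IsMonomialOrder r) {S : Set (BC k X)} (hS : S.Finite)
    (h : IsGSB r S (AlgIdeal.span k S)) :
    IsLeadBasis r (AlgIdeal.Quotient.mkHom (AlgIdeal.span k S)) (leadPairs r S) where
  finite := leadPairs_finite hr hS
  isPair _ hμ := hμ.1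
  exists_lead := by
    rintro μ ⟨_, s, hs, hμ⟩
    exact ⟨s, (AlgIdeal.Quotient.mkHom_eq_zero _).mpr (AlgIdeal.subset_span S hs), hμ⟩
  divides f μ hf hμ hp := by
    obtain ⟨g, ν, hg, hgν, hfν⟩ := h.leading f ((AlgIdeal.Quotient.mkHom_eq_zero _).mp hf) (by
      rintro rfl
      exact hμ.1 rfl)
    rw [hfν.unique hr hμ] at hgν
    exact (exists_isNormalPoly_iff hr hp).mp ⟨g, hg, hgν⟩

open Classical in
theorem exists_le_count_mem [Finite X] (N : ℕ) {w : Multiset X} (hw : w ≠ 0) :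
    ∃ t : Multiset X, t ≠ 0 ∧ t ≤ w ∧ (∀ x, t.count x ∈ ({0, 1, N + 1} : Set ℕ)) ∧
      ∀ x, N < w.count x → N < t.count x := by
  have := Fintype.ofFinite X
  -- If some exponent exceeds N, keep just those variables, with exponent N + 1. Otherwise a single
  -- letter keeps the word nonempty, which is why the exponent 1 is admitted.
  by_cases h : ∃ x, N < w.count x
  · have hc : ∀ x, (∑ y, (if N < w.count y then N + 1 else 0) • ({y} : Multiset X)).count x =
        if N < w.count x then N + 1 else 0 := by
      intro x
      simp only [Multiset.count_sum', Multiset.count_nsmul, Multiset.count_singleton, mul_ite,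
        mul_one, mul_zero, Finset.sum_ite_eq, Finset.mem_univ, if_true]
    refine ⟨∑ y, (if N < w.count y then N + 1 else 0) • {y}, fun h0 => ?_,
      Multiset.le_iff_count.mpr fun x => ?_, fun x => ?_, fun x hx => ?_⟩
    · obtain ⟨x, hx⟩ := h
      have := hc x
      rw [h0, if_pos hx] at this
      simp at this
    · rw [hc]
      split_ifs with hx
      · exact hx
      · exact Nat.zero_le _
    · rw [hc]
      split_ifs <;> simp
    · rw [hc, if_pos hx]
      omega
  · push Not at h
    obtain ⟨z, hz⟩ := Multiset.exists_mem_of_ne_zero hw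
    refine ⟨{z}, by simp, by simpa using hz, fun x => ?_, fun x hx => absurd hx (by
      have := h x
      omega)⟩
    rw [Multiset.count_singleton]
    split_ifs <;> simp

variable [Fintype X]

theorem exponent_le_NS [Nonempty X] (hr : NF.IsMonomialOrder r) {S : Set (BC k X)} (hS : S.Finite) :
    ∀ μ ∈ leadPairs r S, ∀ j, μ.exponent j ≤ NS r S := by
  classical
  have hcount : ∀ (n : ℕ) (x : X), (n • (Finset.univ : Finset X).val).count x = n := by
    intro n x
    rw [Multiset.count_nsmul, Multiset.count_eq_one_of_mem Finset.univ.nodup (by simp), mul_one]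
  have hne : ∀ n : ℕ, 1 ≤ n → n • (Finset.univ : Finset X).val ≠ 0 := by
    intro n hn h
    obtain ⟨x⟩ := ‹Nonempty X›
    have := hcount n x
    rw [h] at this
    simp at this
    omega
  by_cases hS0 : S = ∅
  · subst hS0
    rw [NS, if_pos rfl]
    rintro μ ⟨_, s, hs, _⟩
    exact hs.elim
  obtain ⟨L, hL⟩ := ((finite_setOf_isLeading hr hS).image NF.length).bddAbove
  have hmem := Nat.sInf_mem (s := {n | ∃ hn : n • (Finset.univ : Finset X).val ≠ 0,
    ∀ s ∈ S, ∀ μ, IsLeading r s μ →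
      μ.Divides (NF.pair (n • Finset.univ.val) (n • Finset.univ.val) hn hn)}) (by
    -- L bounds the lengths of all leading monomials, hence their exponents. The added 1 makes the
    -- word nonempty and lets every letter occur in it.
    refine ⟨L + 1, hne _ (by omega), fun s hs μ hμ => ?_⟩
    have hl : μ.length ≤ L := hL ⟨μ, ⟨s, hs, hμ⟩, rfl⟩
    cases μ with
    | letter x => exact .inl (Multiset.count_pos.mp (by rw [hcount]; omega))
    | pair u v hu hv =>
      simp only [NF.length] at hl
      refine ⟨Multiset.le_iff_count.mpr fun x => ?_, Multiset.le_iff_count.mpr fun x => ?_⟩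
      · rw [hcount]
        have := Multiset.count_le_card x u
        omega
      · rw [hcount]
        have := Multiset.count_le_card x v
        omega)
  rw [NS, if_neg hS0]
  obtain ⟨hn, hdiv⟩ := hmem
  rintro μ ⟨hp, s, hs, hμ⟩ j
  refine ((hp.divides_iff (ν := NF.pair _ _ hn hn) trivial).mp (hdiv s hs μ hμ) j).trans (le_of_eq ?_)
  cases j with
  | inl x => simp only [NF.exponent]; convert hcount _ x
  | inr x => simp only [NF.exponent]; convert hcount _ x

theorem testSet_subset (hr : NF.IsMonomialOrder r) (S : Set (BC k X)) :
    testSet r S ⊆ irrPairs (leadPairs r S) := by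
  rintro μ ⟨hirr, u, v, hu, hv, rfl, _⟩
  exact (mem_irrPairs_leadPairs hr (μ := NF.pair u v hu hv) trivial).mpr hirr

theorem testSet_finite (S : Set (BC k X)) : (testSet r S).Finite := by
  classical
  refine Set.Finite.of_injOn (f := NF.exponent) (t := Set.Iic fun _ => NS r S + 1) ?_
    (NF.exponent_injOn.mono ?_) (Set.finite_Iic _)
  · rintro μ ⟨hirr, u, v, hu, hv, rfl, h⟩
    have h' : ∀ n ∈ ({0, 1, NS r S + 1} : Set ℕ), n ≤ NS r S + 1 := by
      rintro n (rfl | rfl | rfl) <;> omega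
    rintro (x | x)
    · exact h' _ (h x).1
    · exact h' _ (h x).2
  · rintro μ ⟨hirr, u, v, hu, hv, rfl, h⟩
    trivial

/-- Truncate both words of μ by `exists_le_count_mem`: divisors of an irreducible pair are
irreducible, and every exponent above the bound stays above it. -/
theorem exists_mem_testSet (hr : NF.IsMonomialOrder r) {S : Set (BC k X)} {μ : NF X} (hμ : μ ∈ irrPairs (leadPairs r S)) :
    ∃ ν ∈ testSet r S, Sd (NS r S) μ ≤ Sd (NS r S) ν := by
  classical
  obtain ⟨hp, hirr⟩ := hμ
  cases μ with
  | letter x => exact hp.elim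
  | pair u v hu hv =>
    obtain ⟨u', hu', hle, hmem, hgt⟩ := exists_le_count_mem (NS r S) hu
    obtain ⟨v', hv', hle', hmem', hgt'⟩ := exists_le_count_mem (NS r S) hv
    refine ⟨NF.pair u' v' hu' hv', ⟨?_, u', v', hu', hv', rfl, fun x => ⟨hmem x, hmem' x⟩⟩, ?_⟩
    · refine (mem_irrPairs_leadPairs hr (μ := NF.pair u' v' hu' hv') trivial).mp ⟨trivial, fun ν hν hd => hirr ν hν ?_⟩
      exact hν.1.divides_trans hd ⟨hle, hle'⟩
    · rw [Sd, Sd]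
      exact Nat.add_le_add
        (Finset.card_le_card (Finset.monotone_filter_right _ fun x _ => hgt x))
        (Finset.card_le_card (Finset.monotone_filter_right _ fun x _ => hgt' x))

theorem GKdim_BCPres [Nonempty X] (hr : NF.IsMonomialOrder r) {S : Set (BC k X)}
    (hS : S.Finite) (h : IsGSB r S (AlgIdeal.span k S)) :
    GKdim k (BCPres S) = (SdSet (NS r S) (testSet r S) : EReal) := by
  have hfin : (Sd (NS r S) '' testSet r S).Finite := (testSet_finite S).image _
  refine (h.isLeadBasis hr hS).GKdim_eq hr (AlgIdeal.Quotient.mkHom_surjective _)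
    (exponent_le_NS hr hS) (fun μ hμ => ?_) ?_
  · obtain ⟨ν, hν, hle⟩ := exists_mem_testSet hr hμ
    exact hle.trans (le_csSup hfin.bddAbove ⟨ν, hν, rfl⟩)
  · rcases (testSet r S).eq_empty_or_nonempty with h0 | h0
    · left
      simp [SdSet, h0]
    · right
      obtain ⟨μ, hμ, e⟩ := Nat.sSup_mem (h0.image _) hfin.bddAbove
      exact ⟨μ, testSet_subset hr S hμ, e⟩

end Presentation

/-! ### Part (2): finitely generated algebras -/

section FinitelyGenerated

/-- Monomial orders exist. -/
theorem NF.exists_isMonomialOrder (X : Type*) [Finite X] :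
    ∃ r : NF X → NF X → Prop, IsMonomialOrder r := by
  classical
  let _ : LinearOrder X := IsWellOrder.linearOrder WellOrderingRel
  let e : Multiset X → Lex (X →₀ ℕ) := fun u => toLex (Multiset.toFinsupp u)
  have e_inj : Function.Injective e := fun u v h => Multiset.toFinsupp.injective (toLex.injective h)
  have e_add : ∀ u v, e (u + v) = e u + e v := fun u v => by simp [e]
  have e_cons : ∀ x v, e (x ::ₘ v) = e {x} + e v := fun x v => by
    rw [← Multiset.singleton_add, e_add]
  -- Compare lengths first, then both words lexicographically. A letter is recorded in both slots
  -- because it may become a left or a right factor.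
  let key : NF X → ℕ ×ₗ (Lex (X →₀ ℕ) ×ₗ Lex (X →₀ ℕ)) := fun μ => match μ with
    | letter x => toLex (1, toLex (e {x}, e {x}))
    | pair u v _ _ => toLex (u.card + v.card, toLex (e u, e v))
  have key_inj : Function.Injective key := by
    intro μ ν h
    have hlen : μ.length = ν.length := by
      cases μ <;> cases ν <;> exact congrArg (fun a => (ofLex a).1) h
    have h1 := congrArg (fun a => (ofLex (ofLex a).2).1) h
    have h2 := congrArg (fun a => (ofLex (ofLex a).2).2) h
    cases μ with
    | letter x =>
      cases ν with
      | letter y => simpa using e_inj h1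
      | pair u v hu hv =>
        have := IsPair.two_le_length (μ := pair u v hu hv) trivial
        rw [← hlen, length] at this
        omega
    | pair u v hu hv =>
      cases ν with
      | letter y =>
        have := IsPair.two_le_length (μ := pair u v hu hv) trivial
        rw [hlen, length] at this
        omega
      | pair u' v' hu' hv' =>
        have h1' : u = u' := e_inj h1
        have h2' : v = v' := e_inj h2
        subst h1' h2'
        rfl
  have lt_iff : ∀ (m n : ℕ) (a b c d : Lex (X →₀ ℕ)),
      toLex (m, toLex (a, b)) < toLex (n, toLex (c, d)) ↔
        m < n ∨ m = n ∧ (a < c ∨ a = c ∧ b < d) := by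
    intro m n a b c d
    rw [Prod.Lex.toLex_lt_toLex, Prod.Lex.toLex_lt_toLex]
  refine ⟨fun μ ν => key μ < key ν, ?_, ?_, ?_⟩
  · exact (RelEmbedding.preimage ⟨key, key_inj⟩ (· < ·)).isWellOrder
  · intro μ ν ρ h
    cases μ <;> cases ν <;> cases ρ <;>
      simp only [letter_mul_letter, letter_mul_pair, pair_mul_letter, pair_mul_pair, key, lt_iff,
        Multiset.card_cons, Multiset.card_add, Multiset.card_singleton, e_cons, e_add] at h ⊢
    all_goals
      simp only [add_lt_add_iff_left, add_lt_add_iff_right, add_left_inj, lt_irrefl,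
        ne_eq, ← Multiset.card_eq_zero, true_and, false_or] at *
      clear lt_iff key_inj e_inj e_add e_cons
      clear_value e
      grind
  · intro μ ν ρ h
    cases μ <;> cases ν <;> cases ρ <;>
      simp only [letter_mul_letter, letter_mul_pair, pair_mul_letter, pair_mul_pair, key, lt_iff,
        Multiset.card_cons, Multiset.card_add, Multiset.card_singleton, e_cons, e_add] at h ⊢
    all_goals
      simp only [add_lt_add_iff_left, add_lt_add_iff_right, add_right_inj, lt_irrefl,
        ne_eq, ← Multiset.card_eq_zero, true_and, false_or] at *
      clear lt_iff key_inj e_inj e_add e_cons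
      clear_value e
      grind

variable {k : Type*} [Field k] {X : Type*} {A : Type*} [NonUnitalNonAssocRing A] [Module k A]

/-- Dickson's lemma: the minimal exponent vectors of leading pairs form an antichain in a power of
ℕ, which is finite by well-quasi-ordering, and every leading pair is divisible by a minimal one. -/
theorem exists_isLeadBasis [Finite X] (r : NF X → NF X → Prop) (φ : BC k X →ₙₐ[k] A) :
    ∃ M, IsLeadBasis r φ M := by
  let W : Set (NF X) := {μ | μ.IsPair ∧ ∃ f, φ f = 0 ∧ IsLeading r f μ}
  let P : (X ⊕ X → ℕ) → Prop := fun a => a ∈ NF.exponent '' W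
  refine ⟨{μ ∈ W | Minimal P μ.exponent}, ?_, fun μ hμ => hμ.1.1, fun μ hμ => hμ.1.2,
    fun f μ hf hμ hp => ?_⟩
  · refine Set.Finite.of_injOn (f := NF.exponent) (t := {a | Minimal P a}) (fun μ hμ => hμ.2)
      (NF.exponent_injOn.mono fun μ hμ => hμ.1.1) ?_
    exact WellQuasiOrderedLE.finite_of_isAntichain (setOfPred_minimal_antichain P)
  · obtain ⟨b, hb, hmin⟩ := exists_minimal_le_of_wellFoundedLT P μ.exponent
      ⟨μ, ⟨hp, f, hf, hμ⟩, rfl⟩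
    obtain ⟨ν, hν, rfl⟩ := hmin.prop
    exact ⟨ν, ⟨hν, hmin⟩, (hν.1.divides_iff hp).mpr hb⟩

/-- The universal property presents A as a quotient of the free algebra on its generators. No finite
Gröbner–Shirshov basis is needed, only a finite generating set of leading pairs; N can be any bound
on their lengths. -/
theorem exists_GKdim_eq_natCast [IsScalarTower k A A] [SMulCommClass k A A] [IsBicommutative A]
    (s : Finset A) (hs : NonUnitalAlgebra.adjoin k (s : Set A) = ⊤) :
    ∃ d : ℕ, GKdim k A = (d : EReal) := by
  obtain ⟨φ, hφ, -⟩ := BC.existsUnique_hom (k := k) (fun x : s => (x : A))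
  have hsurj : Function.Surjective φ := by
    intro a
    have h : NonUnitalAlgebra.adjoin k (s : Set A) ≤ NonUnitalAlgHom.range φ :=
      NonUnitalAlgebra.adjoin_le fun x hx => ⟨BC.gen ⟨x, hx⟩, hφ ⟨x, hx⟩⟩
    rw [hs] at h
    exact h (x := a) trivial
  obtain ⟨r, hr⟩ := NF.exists_isMonomialOrder s
  obtain ⟨M, hM⟩ := exists_isLeadBasis r φ
  obtain ⟨N, hN⟩ := (hM.finite.image NF.length).bddAbove
  have hN' : ∀ μ ∈ M, ∀ j, μ.exponent j ≤ N := fun μ hμ j =>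
    (μ.exponent_le_length j).trans (hN ⟨μ, hμ, rfl⟩)
  have hbdd : BddAbove (Sd N '' irrPairs M) := ⟨_, by
    rintro _ ⟨μ, -, rfl⟩
    exact Sd_le N μ⟩
  refine ⟨SdSet N (irrPairs M), hM.GKdim_eq hr hsurj hN'
    (fun μ hμ => le_csSup hbdd ⟨μ, hμ, rfl⟩) ?_⟩
  rcases (irrPairs M).eq_empty_or_nonempty with h0 | h0
  · left
    simp [SdSet, h0]
  · right
    obtain ⟨μ, hμ, e⟩ := Nat.sSup_mem (h0.image _) hbdd
    exact ⟨μ, hμ, e⟩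

end FinitelyGenerated

end Bicomm

theorem mainTheorem1 :
    (∀ (k : Type*) [Field k] (X : Type*) [Fintype X] [Nonempty X]
      (r : Bicomm.NF X → Bicomm.NF X → Prop) (_ : Bicomm.NF.IsMonomialOrder r)
      (S : Set (Bicomm.BC k X)) (_ : S.Finite)
      (_ : Bicomm.IsGSB r S (Bicomm.AlgIdeal.span k S)),
      (Bicomm.testSet r S).Finite ∧
      Bicomm.GKdim k (Bicomm.BCPres S) =
        ((Bicomm.SdSet (Bicomm.NS r S) (Bicomm.testSet r S) : ℕ) : EReal)) ∧
    (∀ (k : Type*) [Field k] (A : Type*) [NonUnitalNonAssocRing A] [Module k A]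
      [IsScalarTower k A A] [SMulCommClass k A A] [Bicomm.IsBicommutative A],
      (∃ s : Finset A, NonUnitalAlgebra.adjoin k (s : Set A) = ⊤) →
        ∃ d : ℕ, Bicomm.GKdim k A = (d : EReal)) := by
  refine ⟨fun k _ X _ _ r hr S hS h => ⟨Bicomm.testSet_finite S, Bicomm.GKdim_BCPres hr hS h⟩, ?_⟩
  rintro k _ A _ _ _ _ _ ⟨s, hs⟩
  exact Bicomm.exists_GKdim_eq_natCast s hs
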